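/- **Setting.** Let $\mathfrak M$ be a smooth matchbox manifold of dimension $n$: a compact connected metrizable space with a finite atlas of foliation charts $\widehat\varphi_i\colon \widehat U_i\to(-2,2)^n\times\mathfrak T_i$ ($1\le i\le\nu$), where each $\mathfrak T_i$ is a clopen subset of a compact totally disconnected metric space $(\mathfrak X, d_{\mathfrak X})$ and the leafwise transition maps are smooth and depend continuously on the transverse coordinate in the $C^\infty$-topology. Let $\mathfrak M$ carry a leafwise Riemannian metric $g$ with the same regularity. Let $\lambda_i,\pi_i$ be the components of $\widehat\varphi_i$, put $U_i=\lambda_i^{-1}((-1,1)^n)$ and $\overline U_i=\lambda_i^{-1}([-1,1]^n)$, and assume that the $U_i$ cover $\mathfrak M$. The plaque of $x\in\overline U_i$ is $\mathcal P_i(x)=\{z\in\overline U_i:\pi_i(z)=\pi_i(x)\}$. For $r\ge0$ let $\mathfrak Z(x,i,r)=\{x'\in\overline U_i:\lambda_i(x')=\lambda_i(x),\ d_{\mathfrak X}(\pi_i(x),\pi_i(x'))\le r\}$, and for $x'\in\mathfrak Z(x,i,r)$ let $\phi_i(x,x')\colon\mathcal P_i(x)\to\mathcal P_i(x')$ be the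 translation that preserves $\lambda_i$. Let $d_{\mathcal F}$ be the leafwise path-length distance ($\infty$ between different leaves), $D_{\mathcal F}(x,r)$ its closed disks, $D(r)$ the closed $r$-disk about $0$ in Euclidean $\mathbb R^n$, and, for an orthonormal frame $\widehat u$ of $T_x\mathcal F$, let $\psi^g_{x,\widehat u}(\vec a)=\exp^{\mathcal F}_x(\sum_j a_j\vec u_j)$. A subset of $\mathfrak M$ is strongly convex if any two of its points are joined by a unique shortest leafwise geodesic segment, and this segment lies in the set. **Approximately Euclidean coordinates.** Let $D_{\mathcal F}(x,\lambda)\subset\mathcal P_i(x)$, let $\widehat u$ be an orthonormal frame of $T_x\mathcal F$, expressed in the coordinates of $\widehat\varphi_i$, and let $A(\vec a)=\lambda_i(x)+\sum_j a_j\vec u_j$. For $\varepsilon>0$, $\psi^g_{x,\widehat u}$ is *$\varepsilon$-approximately Euclidean on $D(\lambda)$* if $A(D(\lambda))\subset(-2,2)^n$ and, in the plaque through $x$ in the chart $\widehat\varphi_i$: (1) $|g_{A(\vec a)}(\vec u_j,\vec u_k)-\delta_{jk}|\le\varepsilon/n^2$ for all $\vec a\in D(\lambda)$ and all $j,k$;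 (2) $d_{\mathcal F}\big(\psi^g_{x,\widehat u}(\vec a),\widehat\varphi_i^{-1}(A(\vec a),\pi_i(x))\big)\le\varepsilon\|\vec a\|$ for all $\vec a\in D(\lambda)$; (3) for each geodesic $\sigma\colon[0,1]\to D_{\mathcal F}(x,\lambda)$ and each $t\in[0,1]$, $\sigma(t)$ is within $d_{\mathcal F}$-distance $\varepsilon\, d_{\mathcal F}(\sigma(0),\sigma(1))$ of the point with coordinates $\big(\lambda_i(\sigma(0))+t\,(\lambda_i(\sigma(1))-\lambda_i(\sigma(0))),\,\pi_i(x)\big)$; (4) for all $0<s\le\lambda$, $|\mathrm{Vol}(D(s))-\mathrm{Vol}_g(D_{\mathcal F}(x,s))|\le\varepsilon s^n$, and $|\mathrm{Vol}(V)-\mathrm{Vol}_g(\psi^g_{x,\widehat u}(V))|\le\varepsilon s^n$ for every open $V\subset D(s)$. **Constants.** Let the following be given. * $\lambda_{\mathcal F}>0$ such that for every $x\in\mathfrak M$ all disks $D_{\mathcal F}(x,\lambda)$ with $0<\lambda\le\lambda_{\mathcal F}$ are strongly convex and $\exp^{\mathcal F}_x$ is injective on the closed $\lambda_{\mathcal F}$-disk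 in $T_x\mathcal F$; and $0<\delta<\lambda_{\mathcal F}/4$ such that every plaque is strongly convex, contains the disk of radius $\delta/2$ about its center $\widehat\varphi_i^{-1}(0,w)$, and lies in the disk of radius $\delta$ about its center. * $\epsilon_n>0$ and a monotone continuous $\delta_n\colon[0,\epsilon_n]\to[0,\epsilon_n]$, $\delta_n(0)=0$, $\delta_n(\epsilon)>0$ for $\epsilon>0$, such that for $0<\epsilon\le\epsilon_n$ every basis $(\vec f_j')$ of $\mathbb R^n$ with $\big|\|\vec f'_j\|-1\big|<\delta_n(\epsilon)$ for all $j$ and $|\vec f'_j\bullet\vec f'_k|<\delta_n(\epsilon)$ for $j\ne k$ admits an orthonormal basis $(\vec f_j)$ with $\|\vec f_j-\vec f_j'\|\le\epsilon$ for all $j$. * $0<\varepsilon_4\le\epsilon_n$ and $\varepsilon_0>0$ with $\varepsilon_0<1/2000$, $\varepsilon_0<\varepsilon_4/20$ and $\varepsilon_0<\delta_n(\varepsilon_4)/100$. * $\lambda_{\varepsilon_0}>0$ such that for all $0<\lambda\le\min\{\lambda_{\varepsilon_0},\lambda_{\mathcal F}/2\}$, all $i$, all $x\in\overline U_i$ with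 $D_{\mathcal F}(x,\lambda)\subset\mathcal P_i(x)$ and all orthonormal frames $\widehat u$ of $T_x\mathcal F$, $\psi^g_{x,\widehat u}$ is $\varepsilon_0$-approximately Euclidean on $D(\lambda)$ in the chart $\widehat\varphi_i$. * $r_{\mathcal F}=\min\{\delta,\lambda_{\mathcal F}/5,\lambda_{\varepsilon_0},1\}$. * $r_*>0$ such that (a) for all $i$, $x\in\overline U_i$, $x'\in\mathfrak Z(x,i,r_*)$ and $y,z\in\mathcal P_i(x)$, $|d_{\mathcal F}(y,z)-d_{\mathcal F}(\phi_i(x,x')(y),\phi_i(x,x')(z))|\le\varepsilon_0r_{\mathcal F}$; and (b) $d_{\mathcal F}(x',y')\le\varepsilon_0r_{\mathcal F}$ whenever $z\in\overline U_i\cap\overline U_j$, $x'\in\mathfrak Z(z,i,r_*)$, $y'\in\mathfrak Z(z,j,r_*)$ and $\mathcal P_i(x')\cap\mathcal P_j(y')\ne\emptyset$. **Proposition 15.3.** Let $D_{\mathcal F}(x,r_{\mathcal F})\subset U_i$, $y\in D_{\mathcal F}(x,r_{\mathcal F}/2)$, $x'\in\mathfrak Z(x,i,r_*)$, and $y'=\phi_i(x,x')(y)$.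 Let $\widehat u$ be an orthonormal frame of $T_x\mathcal F$, put $\xi=(\psi^g_{x,\widehat u})^{-1}(y)$, and let $T_\xi(\vec a)=\vec a+\xi$. Then there is an orthonormal frame $\widehat v$ of $T_{y'}\mathcal F$ such that $$\Psi_{x,y'}=(\psi^g_{y',\widehat v})^{-1}\circ\phi_i(x,x')\circ\psi^g_{x,\widehat u}\circ T_\xi\colon D(r_{\mathcal F}/2)\to\mathbb R^n$$ is well defined (the inverses being those of the geodesic coordinates on $D(\lambda_{\mathcal F})$) and $\|\Psi_{x,y'}(\vec a)-\vec a\|\le\varepsilon_4\,r_{\mathcal F}$ for all $\vec a\in D(r_{\mathcal F}/2)$. -/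

import Mathlib

open Set Filter Topology MeasureTheory
open scoped ENNReal ContDiff

namespace Matchbox

/-- Euclidean `n`-space. -/
abbrev E (n : ℕ) : Type := EuclideanSpace ℝ (Fin n)

/-- The open cube `(-r, r)^n`. -/
def box (n : ℕ) (r : ℝ) : Set (E n) := {u | ∀ k, |u k| < r}

/-- The closed cube `[-r, r]^n`. -/
def closedBox (n : ℕ) (r : ℝ) : Set (E n) := {u | ∀ k, |u k| ≤ r}

/-- `f` is smooth in the leaf variable `u` on the open set `S`, and all its derivatives in `u` are
jointly continuous in `(u, w)`; that is, `f( · , w)` depends continuously on `w` in the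
`C^∞`-topology. -/
def SmoothAlong {n : ℕ} {X F : Type*} [TopologicalSpace X] [NormedAddCommGroup F]
    [NormedSpace ℝ F] (S : Set (E n × X)) (f : E n × X → F) : Prop :=
  (∀ p ∈ S, ContDiffAt ℝ ∞ (fun u => f (u, p.2)) p.1) ∧
  ∀ k : ℕ, ContinuousOn (fun p : E n × X => iteratedFDeriv ℝ k (fun u => f (u, p.2)) p.1) S

end Matchbox

open Matchbox in
/-- The structure of a smooth `n`-dimensional matchbox manifold on the space `M`, with transverse
model space `X`, given by a finite foliated atlas, together with a leafwise Riemannian metric.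

(`M` compact, connected and metrizable, and `X` compact, metrizable and totally disconnected are
type class assumptions wherever this structure is used.)

The chart `chart i` is the extended chart onto `(-2, 2)^n × T i`; the closed flow box is the part
over `[-1, 1]^n`, and the open flow boxes, over `(-1, 1)^n`, cover `M`. That the transverse
coordinate is locally constant along plaques is automatic, because `X` is totally disconnected. -/
structure MatchboxManifold (n ν : ℕ) (M X : Type*) [MetricSpace M] [MetricSpace X] where
  /-- the local transverse models -/
  T : Fin ν → Set X
  isClopen_T : ∀ i, IsClopen (T i)
  /-- the extended foliation charts -/
  chart : Fin ν → OpenPartialHomeomorph M (E n × X)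
  chart_target : ∀ i, (chart i).target = box n 2 ×ˢ T i
  cover : ∀ z, ∃ i, z ∈ (chart i).source ∧ (chart i z).1 ∈ box n 1
  smooth_transition : ∀ i j, SmoothAlong ((chart i).symm.trans (chart j)).source
    (fun p => (chart j ((chart i).symm p)).1)
  /-- the leafwise metric tensor, in the coordinates of each chart -/
  g : Fin ν → E n × X → E n →L[ℝ] E n →L[ℝ] ℝ
  g_symm : ∀ i, ∀ p ∈ (chart i).target, ∀ a b, g i p a b = g i p b a
  g_pos : ∀ i, ∀ p ∈ (chart i).target, ∀ a, a ≠ 0 → 0 < g i p a a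
  g_smooth : ∀ i, SmoothAlong (chart i).target (g i)
  g_compat : ∀ i j, ∀ p ∈ ((chart i).symm.trans (chart j)).source, ∀ a b,
    g i p a b = g j (chart j ((chart i).symm p))
      (fderiv ℝ (fun u => (chart j ((chart i).symm (u, p.2))).1) p.1 a)
      (fderiv ℝ (fun u => (chart j ((chart i).symm (u, p.2))).1) p.1 b)

namespace MatchboxManifold

open Matchbox

variable {n ν : ℕ} {M X : Type*} [MetricSpace M] [MetricSpace X] (𝔐 : MatchboxManifold n ν M X)

/-! ### Flow boxes, plaques, transversals -/

/-- Horizontal coordinate `λ_i`. -/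
noncomputable def hor (i : Fin ν) (z : M) : E n := (𝔐.chart i z).1

/-- Transverse coordinate `π_i`. -/
noncomputable def trans (i : Fin ν) (z : M) : X := (𝔐.chart i z).2

/-- The open flow box `U_i`. -/
def flowBox (i : Fin ν) : Set M := {z | z ∈ (𝔐.chart i).source ∧ 𝔐.hor i z ∈ box n 1}

/-- The closed flow box, the closure of `U_i`. -/
def closedFlowBox (i : Fin ν) : Set M := {z | z ∈ (𝔐.chart i).source ∧ 𝔐.hor i z ∈ closedBox n 1}

/-- The (closed) plaque of the chart `i` over `w`. -/
def plaque (i : Fin ν) (w : X) : Set M := {z | z ∈ 𝔐.closedFlowBox i ∧ 𝔐.trans i z = w}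

/-- The disk section of radius `r` through `x`: the points of the closed flow box with the same
horizontal coordinate as `x`, whose transverse coordinate is at distance at most `r` from that
of `x`. -/
def diskSection (i : Fin ν) (x : M) (r : ℝ) : Set M :=
  {z | z ∈ 𝔐.closedFlowBox i ∧ 𝔐.hor i z = 𝔐.hor i x ∧ dist (𝔐.trans i z) (𝔐.trans i x) ≤ r}

/-- Vertical translation `z ↦ φ_i(x, x')(z)` to the plaque of `x'`: keep the horizontal coordinate
and replace the transverse one by that of `x'`. -/
noncomputable def transport (i : Fin ν) (x' z : M) : M :=
  (𝔐.chart i).symm (𝔐.hor i z, 𝔐.trans i x')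

/-! ### The leafwise distance -/

/-- `LeafPath x y ℓ`: there is a piecewise `C^1` leafwise curve of length `ℓ` from `x` to `y`,
presented as a finite concatenation of `C^1` arcs, each inside a plaque of an extended chart. -/
inductive LeafPath : M → M → ℝ → Prop
  | nil (x : M) : LeafPath x x 0
  | cons {i : Fin ν} {w : X} {c : ℝ → E n} {z : M} {l : ℝ} (hw : w ∈ 𝔐.T i)
      (hc : ContDiffOn ℝ 1 c (Icc 0 1)) (hbox : ∀ t ∈ Icc (0 : ℝ) 1, c t ∈ box n 2)
      (rest : LeafPath ((𝔐.chart i).symm (c 1, w)) z l) :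
      LeafPath ((𝔐.chart i).symm (c 0, w)) z
        ((∫ t in (0 : ℝ)..1, Real.sqrt (𝔐.g i (c t, w) (derivWithin c (Icc 0 1) t)
          (derivWithin c (Icc 0 1) t))) + l)

/-- The leafwise distance: the infimum of the lengths of the piecewise `C^1` leafwise curves, which
is `∞` for points on different leaves. -/
noncomputable def leafDist (x y : M) : ℝ≥0∞ :=
  ⨅ (l : ℝ) (_ : 𝔐.LeafPath x y l), ENNReal.ofReal l

/-- The closed leafwise disk `D_F(x, r)`. -/
def leafDisk (x : M) (r : ℝ) : Set M := {y | 𝔐.leafDist x y ≤ ENNReal.ofReal r}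

/-! ### Leafwise geodesics and the exponential map -/

/-- `γ` is a complete leafwise geodesic: in every chart the transverse coordinate is locally
constant and the horizontal coordinate `c`, with velocity `v` and acceleration `a`, satisfies the
geodesic equation `a^l + Γ^l_{jk} v^j v^k = 0`. It is written with the index lowered, as
`g(a, b) + (D_v g)(v, b) - (1/2) (D_b g)(v, v) = 0` for all `b`. -/
def IsLeafGeodesic (γ : ℝ → M) : Prop :=
  ∀ (t : ℝ) (i : Fin ν), γ t ∈ (𝔐.chart i).source → ∃ v : ℝ → E n, ∀ᶠ s in 𝓝 t,
    γ s ∈ (𝔐.chart i).source ∧ 𝔐.trans i (γ s) = 𝔐.trans i (γ t) ∧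
    HasDerivAt (fun r => 𝔐.hor i (γ r)) (v s) s ∧
    ∃ a : E n, HasDerivAt v a s ∧ ∀ b : E n,
      𝔐.g i (𝔐.chart i (γ s)) a b
        + fderiv ℝ (fun u => 𝔐.g i (u, 𝔐.trans i (γ s))) (𝔐.hor i (γ s)) (v s) (v s) b
        - (1 / 2) * fderiv ℝ (fun u => 𝔐.g i (u, 𝔐.trans i (γ s))) (𝔐.hor i (γ s)) b (v s) (v s)
        = 0

/-- In the coordinates of chart `i`, the geodesic `γ` starts at `x` with velocity `v`. -/
def StartsWith (γ : ℝ → M) (i : Fin ν) (x : M) (v : E n) : Prop :=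
  𝔐.IsLeafGeodesic γ ∧ γ 0 = x ∧ x ∈ (𝔐.chart i).source ∧
    HasDerivAt (fun r => 𝔐.hor i (γ r)) v 0

/-- The restriction of `γ` to `[0, 1]` is a shortest geodesic segment from `p` to `q`: its length,
which is its (constant) speed, equals the leafwise distance. -/
def IsShortestGeodesic (γ : ℝ → M) (p q : M) : Prop :=
  γ 1 = q ∧ ∃ i v, 𝔐.StartsWith γ i p v ∧
    ENNReal.ofReal (Real.sqrt (𝔐.g i (𝔐.chart i p) v v)) = 𝔐.leafDist p q

/-- Strongly convex sets: any two points are joined by a unique shortest geodesic segment, and this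
segment lies in the set. -/
def StronglyConvex (S : Set M) : Prop :=
  ∀ p ∈ S, ∀ q ∈ S, ∃ γ : ℝ → M, 𝔐.IsShortestGeodesic γ p q ∧ (∀ t ∈ Icc (0 : ℝ) 1, γ t ∈ S) ∧
    ∀ γ' : ℝ → M, 𝔐.IsShortestGeodesic γ' p q → γ' = γ

open Classical in
/-- The leafwise exponential map at `x`; the tangent vector `v` is given in the coordinates of the
chart `i`. (Geodesics are determined by their initial velocity, and exist for all times as `M` is
compact; the second branch is never used for `x` in the domain of the chart.) -/
noncomputable def leafExp (i : Fin ν) (x : M) (v : E n) : M :=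
  if h : ∃ γ : ℝ → M, 𝔐.StartsWith γ i x v then h.choose 1 else x

/-- `u` is an orthonormal frame at `x`, in the coordinates of the chart `i`. -/
def IsFrame (i : Fin ν) (x : M) (u : Fin n → E n) : Prop :=
  ∀ j k, 𝔐.g i (𝔐.chart i x) (u j) (u k) = if j = k then 1 else 0

/-- The geodesic coordinates `ψ^g_{x,u}(a) = exp_x(u · a)`. -/
noncomputable def geoCoord (i : Fin ν) (x : M) (u : Fin n → E n) (a : E n) : M :=
  𝔐.leafExp i x (∑ j, a j • u j)

/-- The inverse of the geodesic coordinates `ψ^g_{x,u}` on the disk `D(l)`. -/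
noncomputable def geoCoordInv (l : ℝ) (i : Fin ν) (x : M) (u : Fin n → E n) (p : M) : E n :=
  Function.invFunOn (𝔐.geoCoord i x u) (Metric.closedBall 0 l) p

/-! ### The leafwise scales -/

/-- `lF` is an admissible convexity scale `λ_F`: all leafwise disks of radius at most `lF` are
strongly convex, and `lF` does not exceed the injectivity radius of the leaves, so that geodesic
coordinates are injective on `D(lF)`. -/
def IsConvexityScale (lF : ℝ) : Prop :=
  0 < lF ∧ (∀ x l, 0 < l → l ≤ lF → 𝔐.StronglyConvex (𝔐.leafDisk x l)) ∧
    ∀ i, ∀ x ∈ (𝔐.chart i).source,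
      InjOn (𝔐.leafExp i x) {v | 𝔐.g i (𝔐.chart i x) v v ≤ lF ^ 2}

/-- The atlas is a regular covering, with plaque size `δU`: the plaques are strongly convex, and
each contains the disk of radius `δU / 2` and lies in the disk of radius `δU` about its center. -/
def IsRegular (lF δU : ℝ) : Prop :=
  0 < δU ∧ δU < lF / 4 ∧ ∀ i, ∀ w ∈ 𝔐.T i, 𝔐.StronglyConvex (𝔐.plaque i w) ∧
    𝔐.leafDisk ((𝔐.chart i).symm (0, w)) (δU / 2) ⊆ 𝔐.plaque i w ∧
    𝔐.plaque i w ⊆ 𝔐.leafDisk ((𝔐.chart i).symm (0, w)) δU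

/-- The Riemannian volume of the set with coordinates `S` in the plaque of chart `i` over `w`. -/
noncomputable def leafVol (i : Fin ν) (w : X) (S : Set (E n)) : ℝ :=
  ∫ p in S, Real.sqrt (Matrix.det (Matrix.of fun j k : Fin n =>
    𝔐.g i (p, w) (EuclideanSpace.single j 1) (EuclideanSpace.single k 1)))

/-- The affine coordinates `a ↦ λ_i(x) + u · a`. -/
noncomputable def affCoord (i : Fin ν) (x : M) (u : Fin n → E n) (a : E n) : E n :=
  𝔐.hor i x + ∑ j, a j • u j

/-- The geodesic coordinates `ψ^g_{x,u}` on `D(l)` are `ε`-approximately Euclidean, in the chart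
`i`. -/
structure ApproxEuclidean (ε l : ℝ) (i : Fin ν) (x : M) (u : Fin n → E n) : Prop where
  /-- the affine coordinates stay in the chart -/
  mem_box : ∀ a ∈ Metric.closedBall (0 : E n) l, 𝔐.affCoord i x u a ∈ box n 2
  /-- the metric tensor in the affine coordinates is almost the Euclidean one -/
  metric_close : ∀ a ∈ Metric.closedBall (0 : E n) l, ∀ j k,
    |𝔐.g i (𝔐.affCoord i x u a, 𝔐.trans i x) (u j) (u k) - if j = k then 1 else 0|
      ≤ ε / (n : ℝ) ^ 2
  /-- the geodesic coordinates are almost affine -/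
  exp_close : ∀ a ∈ Metric.closedBall (0 : E n) l,
    𝔐.leafDist (𝔐.geoCoord i x u a) ((𝔐.chart i).symm (𝔐.affCoord i x u a, 𝔐.trans i x))
      ≤ ENNReal.ofReal (ε * ‖a‖)
  /-- geodesic segments in the disk are almost straight in the chart -/
  geodesic_close : ∀ γ : ℝ → M, 𝔐.IsLeafGeodesic γ →
    (∀ t ∈ Icc (0 : ℝ) 1, γ t ∈ 𝔐.leafDisk x l) → ∀ t ∈ Icc (0 : ℝ) 1,
    𝔐.leafDist (γ t) ((𝔐.chart i).symm
        (t • (𝔐.hor i (γ 1) - 𝔐.hor i (γ 0)) + 𝔐.hor i (γ 0), 𝔐.trans i x))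
      ≤ ENNReal.ofReal ε * 𝔐.leafDist (γ 0) (γ 1)
  /-- the volumes of disks are almost Euclidean -/
  vol_disk : ∀ s, 0 < s → s ≤ l →
    |volume.real (Metric.closedBall (0 : E n) s)
      - 𝔐.leafVol i (𝔐.trans i x) (𝔐.hor i '' 𝔐.leafDisk x s)| ≤ ε * s ^ n
  /-- the volumes of open sets are almost preserved by the geodesic coordinates -/
  vol_open : ∀ s, 0 < s → s ≤ l → ∀ U : Set (E n), IsOpen U → U ⊆ Metric.closedBall 0 s →
    |volume.real U - 𝔐.leafVol i (𝔐.trans i x) (𝔐.hor i '' (𝔐.geoCoord i x u '' U))|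
      ≤ ε * s ^ n

/-- `lε` is a scale `λ_ε` below which all geodesic coordinates are `ε`-approximately Euclidean. -/
def IsEuclideanScale (lF ε lε : ℝ) : Prop :=
  0 < lε ∧ ∀ l, 0 < l → l ≤ lε → l ≤ lF / 2 → ∀ i, ∀ x ∈ 𝔐.closedFlowBox i,
    𝔐.leafDisk x l ⊆ 𝔐.plaque i (𝔐.trans i x) →
    ∀ u, 𝔐.IsFrame i x u → 𝔐.ApproxEuclidean ε l i x u

/-! ### The transverse scale -/

/-- `var(i, r) ≤ κ` for all `i`: vertical translations by at most `r` between plaques of one chart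
change leafwise distances by at most `κ`. -/
def VarLE (r κ : ℝ) : Prop :=
  ∀ i, ∀ x ∈ 𝔐.closedFlowBox i, ∀ x' ∈ 𝔐.diskSection i x r,
    ∀ y ∈ 𝔐.plaque i (𝔐.trans i x), ∀ z ∈ 𝔐.plaque i (𝔐.trans i x),
    𝔐.leafDist y z ≤ 𝔐.leafDist (𝔐.transport i x' y) (𝔐.transport i x' z) + ENNReal.ofReal κ ∧
    𝔐.leafDist (𝔐.transport i x' y) (𝔐.transport i x' z) ≤ 𝔐.leafDist y z + ENNReal.ofReal κ

/-- `div(z, r) ≤ κ` for all `z`: the disk sections of radius `r` through `z` in two charts diverge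
by at most `κ`. -/
def DivLE (r κ : ℝ) : Prop :=
  ∀ z i j, z ∈ 𝔐.closedFlowBox i → z ∈ 𝔐.closedFlowBox j →
    ∀ x' ∈ 𝔐.diskSection i z r, ∀ y' ∈ 𝔐.diskSection j z r,
    (𝔐.plaque i (𝔐.trans i x') ∩ 𝔐.plaque j (𝔐.trans j y')).Nonempty →
    𝔐.leafDist x' y' ≤ ENNReal.ofReal κ

/-! ### The comparison map -/

/-- With `y' = φ_i(x, x')(y)` and `ξ = (ψ^g_{x,u})⁻¹(y)`, the comparison map
`Ψ_{x,y'} = (ψ^g_{y',v})⁻¹ ∘ φ_i(x, x') ∘ ψ^g_{x,u} ∘ T_ξ`. -/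
noncomputable def comparison (lF : ℝ) (i : Fin ν) (x x' y : M) (u v : Fin n → E n) (a : E n) :
    E n :=
  𝔐.geoCoordInv lF i (𝔐.transport i x' y) v
    (𝔐.transport i x' (𝔐.geoCoord i x u (a + 𝔐.geoCoordInv lF i x u y)))

end MatchboxManifold

open Matchbox in
/-- `δ` is a modulus for the orthonormalization of almost orthonormal bases in Euclidean space, for
errors up to `εmax`: a basis that is orthonormal up to an error `δ ε` is `ε`-close to an orthonormal
one. -/
structure IsOrthonormalizationModulus (n : ℕ) (εmax : ℝ) (δ : ℝ → ℝ) : Prop where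
  pos : 0 < εmax
  mapsTo : MapsTo δ (Icc 0 εmax) (Icc 0 εmax)
  monotone : MonotoneOn δ (Icc 0 εmax)
  continuous : ContinuousOn δ (Icc 0 εmax)
  zero : δ 0 = 0
  pos_of_pos : ∀ ε ∈ Ioc 0 εmax, 0 < δ ε
  approx : ∀ ε ∈ Ioc 0 εmax, ∀ f' : Fin n → E n, LinearIndependent ℝ f' →
    (∀ j, 1 - δ ε < ‖f' j‖ ∧ ‖f' j‖ < 1 + δ ε) →
    (∀ j k, j ≠ k → |inner ℝ (f' j) (f' k)| < δ ε) →
    ∃ f : Fin n → E n, Orthonormal ℝ f ∧ ∀ j, ‖f j - f' j‖ ≤ ε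

/-! The translation `φ_i(x, x')` is the identity in the horizontal coordinate `λ_i`, and geodesic
coordinates are almost affine in it. With `U` and `V` the linear maps of the frames `u` and `v`, the
point `ψ_{x,u}(a + ξ)` has horizontal coordinate close to `λ_i(x) + U(a + ξ)`, that is, to `λ_i(y) +
U a`, while `ψ_{y',v}(b)` has one close to `λ_i(y') + V b`. As `λ_i(y') = λ_i(y)`, the comparison
map is close to `V⁻¹ U`. It remains to find `v` with `V⁻¹ U` close to the identity and to add up
errors that are multiples of `ε0 * rF`.

The frame (`exists_isFrame_close`). The transverse scale bounds the change of leafwise distances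
only by the additive error `ε0 * rF`. For horizontal vectors of length about `rF` this is a relative
error of order `ε0`, and since norms are homogeneous it is one for all vectors (`norm_symm_le_mul`).
So the norms at `x` and `x'` almost agree; those at `x'` and `y'` do because the metric is almost
constant on the disk about `x'`. Polar decomposition (`exists_frame_close`) turns the near isometry
`U` into an exact one, `V`, with a loss linear in the error.

The errors (`comparison_sub_le`). The approximations are stated as leafwise distances;
`ApproxEuclidean.leafDist_affCoord_le` and `ApproxEuclidean.norm_symm_sub_le` convert between these
and affine coordinates. The latter needs points strictly inside the disk where the metric is
controlled, whereas the image point may lie slightly outside the controlled disk about `y'`. It is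
therefore first pulled back along its geodesic to `y'`, at a cost of order `ε0 * rF`. The total
stays below `20 * (ε0 * rF)`, and `20 * ε0 < ε4`.

Geodesics enter through uniqueness for the geodesic equation, constancy of speed, and strong
convexity, which supplies the shortest segments; their existence for arbitrary initial velocities is
not needed. -/

namespace MatchboxManifold

open Matchbox

variable {n ν : ℕ} {M X : Type*} [MetricSpace M] [MetricSpace X] {𝔐 : MatchboxManifold n ν M X}

/-! ### The leafwise distance is a pseudometric -/

/-- The length of the arc `c` in the plaque over `w`, in the chart `i`. -/
noncomputable def arcLength (𝔐 : MatchboxManifold n ν M X) (i : Fin ν) (w : X) (c : ℝ → E n) : ℝ :=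
  ∫ t in (0 : ℝ)..1, Real.sqrt (𝔐.g i (c t, w) (derivWithin c (Icc 0 1) t)
          (derivWithin c (Icc 0 1) t))

theorem LeafPath.arc {i : Fin ν} {w : X} {c : ℝ → E n} (hw : w ∈ 𝔐.T i)
    (hc : ContDiffOn ℝ 1 c (Icc 0 1)) (hbox : ∀ t ∈ Icc (0 : ℝ) 1, c t ∈ box n 2) :
    𝔐.LeafPath ((𝔐.chart i).symm (c 0, w)) ((𝔐.chart i).symm (c 1, w)) (𝔐.arcLength i w c) := by
  have := LeafPath.cons hw hc hbox (LeafPath.nil _)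
  rwa [add_zero] at this

theorem LeafPath.append {x y z : M} {k l : ℝ} (h : 𝔐.LeafPath x y k) (h' : 𝔐.LeafPath y z l) :
    𝔐.LeafPath x z (k + l) := by
  induction h with
  | nil x => rwa [zero_add]
  | cons hw hc hbox rest ih =>
    rw [add_assoc]
    exact LeafPath.cons hw hc hbox (ih h')

theorem arcLength_comp_one_sub (i : Fin ν) (w : X) (c : ℝ → E n) :
    𝔐.arcLength i w (fun t => c (1 - t)) = 𝔐.arcLength i w c := by
  have hd : ∀ t, derivWithin (fun t => c (1 - t)) (Icc 0 1) t = -derivWithin c (Icc 0 1) (1 - t) := by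
    intro t
    rw [derivWithin_comp_const_sub]
    simp
  unfold arcLength
  simp only [hd, map_neg, _root_.neg_apply, neg_neg]
  rw [intervalIntegral.integral_comp_sub_left (fun t => Real.sqrt (𝔐.g i (c t, w)
    (derivWithin c (Icc 0 1) t) (derivWithin c (Icc 0 1) t))) 1]
  simp

theorem LeafPath.reverse {x y : M} {l : ℝ} (h : 𝔐.LeafPath x y l) : 𝔐.LeafPath y x l := by
  induction h with
  | nil x => exact LeafPath.nil x
  | @cons i w c z l hw hc hbox rest ih =>
    have hmaps : MapsTo (fun t : ℝ => 1 - t) (Icc 0 1) (Icc 0 1) := fun t ht =>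
      ⟨by linarith [ht.2], by linarith [ht.1]⟩
    have := LeafPath.arc hw (hc.comp (by fun_prop) hmaps) (fun t ht => hbox _ (hmaps ht))
    simp only [Function.comp_apply, sub_zero, sub_self] at this
    have h2 := ih.append this
    have h3 := arcLength_comp_one_sub (𝔐 := 𝔐) i w c
    unfold Function.comp at h2
    rw [h3, add_comm] at h2
    exact h2

theorem leafDist_self (x : M) : 𝔐.leafDist x x = 0 := by
  refine le_antisymm ?_ bot_le
  unfold leafDist
  exact iInf₂_le_of_le 0 (LeafPath.nil x) (by simp)

theorem leafDist_comm (x y : M) : 𝔐.leafDist x y = 𝔐.leafDist y x := by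
  unfold leafDist
  exact iInf_congr fun l => iInf_congr_Prop ⟨LeafPath.reverse, LeafPath.reverse⟩ fun _ => rfl

theorem leafDist_triangle (x y z : M) :
    𝔐.leafDist x z ≤ 𝔐.leafDist x y + 𝔐.leafDist y z := by
  conv_rhs => unfold leafDist
  simp only [ENNReal.iInf_add, ENNReal.add_iInf]
  refine le_iInf fun k => le_iInf fun hk => le_iInf fun l => le_iInf fun hl => ?_
  exact (iInf₂_le _ (hl.append hk)).trans ENNReal.ofReal_add_le

theorem leafDist_le_of_le {x y z : M} {s t u : ℝ} (hs : 0 ≤ s) (ht : 0 ≤ t)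
    (h : 𝔐.leafDist x y ≤ ENNReal.ofReal s) (h' : 𝔐.leafDist y z ≤ ENNReal.ofReal t)
    (hu : s + t ≤ u) : 𝔐.leafDist x z ≤ ENNReal.ofReal u := by
  refine ((leafDist_triangle x y z).trans (add_le_add h h')).trans ?_
  rw [← ENNReal.ofReal_add hs ht]
  exact ENNReal.ofReal_le_ofReal hu

theorem leafDist_arc_le {i : Fin ν} {w : X} {c : ℝ → E n} {K : ℝ} (hw : w ∈ 𝔐.T i)
    (hc : ContDiffOn ℝ 1 c (Icc 0 1)) (hbox : ∀ t ∈ Icc (0 : ℝ) 1, c t ∈ box n 2)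
    (hK : ∀ t ∈ Ioo (0 : ℝ) 1, Real.sqrt (𝔐.g i (c t, w) (deriv c t) (deriv c t)) ≤ K) :
    𝔐.leafDist ((𝔐.chart i).symm (c 0, w)) ((𝔐.chart i).symm (c 1, w)) ≤ ENNReal.ofReal K := by
  refine (iInf₂_le _ (LeafPath.arc hw hc hbox)).trans (ENNReal.ofReal_le_ofReal ?_)
  unfold arcLength
  refine (le_abs_self _).trans ?_
  rw [← Real.norm_eq_abs]
  refine (intervalIntegral.norm_integral_le_of_norm_le_const_ae (C := K) ?_).trans (by simp)
  -- The one-sided derivative agrees with `deriv` only in the open interval; the endpoint is a null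
  -- set.
  have : ∀ᵐ t : ℝ, t ≠ 1 := by simp [ae_iff]
  filter_upwards [this] with t ht1 ht
  rw [uIoc_of_le zero_le_one] at ht
  have ht' : t ∈ Ioo (0 : ℝ) 1 := ⟨ht.1, lt_of_le_of_ne ht.2 ht1⟩
  rw [derivWithin_of_mem_nhds (Icc_mem_nhds ht'.1 ht'.2), Real.norm_eq_abs,
    abs_of_nonneg (Real.sqrt_nonneg _)]
  exact hK t ht'

/-! ### The geodesic flow in a chart -/

theorem mem_target {i : Fin ν} {z : M} (hz : z ∈ (𝔐.chart i).source) :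
    (𝔐.hor i z, 𝔐.trans i z) ∈ (𝔐.chart i).target :=
  (𝔐.chart i).map_source hz

theorem mem_target_iff {i : Fin ν} {u : E n} {w : X} :
    (u, w) ∈ (𝔐.chart i).target ↔ u ∈ box n 2 ∧ w ∈ 𝔐.T i := by
  rw [𝔐.chart_target, mem_prod]

theorem symm_hor_trans {i : Fin ν} {z : M} (hz : z ∈ (𝔐.chart i).source) :
    (𝔐.chart i).symm (𝔐.hor i z, 𝔐.trans i z) = z :=
  (𝔐.chart i).left_inv hz

theorem eq_of_hor_trans {i : Fin ν} {y z : M} (hy : y ∈ (𝔐.chart i).source)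
    (hz : z ∈ (𝔐.chart i).source) (h : 𝔐.hor i y = 𝔐.hor i z) (h' : 𝔐.trans i y = 𝔐.trans i z) :
    y = z :=
  (𝔐.chart i).injOn hy hz (Prod.ext h h')

theorem contDiffAt_g {i : Fin ν} {u : E n} {w : X} (h : (u, w) ∈ (𝔐.chart i).target) :
    ContDiffAt ℝ ∞ (fun u => 𝔐.g i (u, w)) u :=
  (𝔐.g_smooth i).1 _ h

theorem g_self_nonneg {i : Fin ν} {p : E n × X} (h : p ∈ (𝔐.chart i).target) (a : E n) :
    0 ≤ 𝔐.g i p a a := by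
  rcases eq_or_ne a 0 with rfl | ha
  · simp
  · exact (𝔐.g_pos i p h a ha).le

/-- The metric tensor as an isomorphism from the tangent to the cotangent space. -/
theorem exists_equiv_g {i : Fin ν} {p : E n × X} (h : p ∈ (𝔐.chart i).target) :
    ∃ e : E n ≃L[ℝ] (E n →L[ℝ] ℝ), (e : E n →L[ℝ] (E n →L[ℝ] ℝ)) = 𝔐.g i p := by
  have hinj : Function.Injective (𝔐.g i p : E n →ₗ[ℝ] (E n →L[ℝ] ℝ)) := by
    rw [← LinearMap.ker_eq_bot, LinearMap.ker_eq_bot']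
    intro a ha
    by_contra hne
    have := 𝔐.g_pos i p h a hne
    have h0 : 𝔐.g i p a = 0 := ha
    simp [h0] at this
  have hdim : Module.finrank ℝ (E n) = Module.finrank ℝ (E n →L[ℝ] ℝ) := by
    rw [← (LinearMap.toContinuousLinearMap (𝕜 := ℝ) (E := E n) (F' := ℝ)).finrank_eq]
    exact (Subspace.dual_finrank_eq (K := ℝ) (V := E n)).symm
  refine ⟨(LinearMap.linearEquivOfInjective _ hinj hdim).toContinuousLinearEquiv, ?_⟩
  ext a b
  rfl

/-- The inhomogeneous term of the geodesic equation, with the index lowered. -/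
noncomputable def geodesicForm (𝔐 : MatchboxManifold n ν M X) (i : Fin ν) (w : X) (q : E n × E n) :
    E n →L[ℝ] ℝ :=
  (1 / 2 : ℝ) • (((fderiv ℝ (fun u => 𝔐.g i (u, w)) q.1).flip q.2).flip q.2)
    - fderiv ℝ (fun u => 𝔐.g i (u, w)) q.1 q.2 q.2

/-- The geodesic spray on the tangent bundle of a plaque, in the chart `i`. -/
noncomputable def spray (𝔐 : MatchboxManifold n ν M X) (i : Fin ν) (w : X) (q : E n × E n) :
    E n × E n :=
  (q.2, (𝔐.g i (q.1, w)).inverse (𝔐.geodesicForm i w q))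

-- A `C^1` vector field is locally Lipschitz, which is what uniqueness of integral curves requires.
-- Inversion is smooth at the metric tensor because that is an isomorphism.
set_option maxSynthPendingDepth 5 in
set_option synthInstance.maxHeartbeats 400000 in
theorem contDiffAt_spray {i : Fin ν} {w : X} {q : E n × E n}
    (h : (q.1, w) ∈ (𝔐.chart i).target) : ContDiffAt ℝ 1 (𝔐.spray i w) q := by
  have hg := contDiffAt_g h
  have hg1 : ContDiffAt ℝ 1 (fun q : E n × E n => 𝔐.g i (q.1, w)) q :=
    ((hg.of_le (m := 1) (by norm_cast)).comp q contDiffAt_fst :)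
  have hd : ContDiffAt ℝ 1 (fun q : E n × E n => fderiv ℝ (fun u => 𝔐.g i (u, w)) q.1) q :=
    ((hg.fderiv_right (m := 1) (by norm_cast)).comp q contDiffAt_fst :)
  have hflip : ∀ {F : Type} [NormedAddCommGroup F] [NormedSpace ℝ F]
      {f : E n × E n → E n →L[ℝ] E n →L[ℝ] F}, ContDiffAt ℝ 1 f q →
      ContDiffAt ℝ 1 (fun q => (f q).flip) q := by
    intro F _ _ f hf
    exact ((ContinuousLinearMap.flipₗᵢ ℝ (E n) (E n) F).toContinuousLinearEquiv.contDiff.contDiffAt.comp q hf :)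
  have hform : ContDiffAt ℝ 1 (𝔐.geodesicForm i w) q := by
    unfold geodesicForm
    refine ContDiffAt.sub ((contDiffAt_const (c := (1 / 2 : ℝ))).smul ?_)
      ((hd.clm_apply contDiffAt_snd).clm_apply contDiffAt_snd)
    exact (hflip ((hflip hd).clm_apply contDiffAt_snd)).clm_apply contDiffAt_snd
  obtain ⟨e, he⟩ := exists_equiv_g h
  have hinv : ContDiffAt ℝ 1 (fun q : E n × E n => (𝔐.g i (q.1, w)).inverse) q := by
    have := contDiffAt_map_inverse (n := 1) e
    rw [he] at this
    exact (this.comp q hg1 :)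
  exact contDiffAt_snd.prodMk (hinv.clm_apply hform)

/-- A leafwise geodesic has locally constant transverse coordinate and differentiable horizontal
coordinate. -/
theorem IsLeafGeodesic.eventually {γ : ℝ → M} (h : 𝔐.IsLeafGeodesic γ) {i : Fin ν} {t : ℝ}
    (ht : γ t ∈ (𝔐.chart i).source) :
    ∀ᶠ s in 𝓝 t, γ s ∈ (𝔐.chart i).source ∧ 𝔐.trans i (γ s) = 𝔐.trans i (γ t) ∧
      DifferentiableAt ℝ (fun r => 𝔐.hor i (γ r)) s := by
  obtain ⟨v, hv⟩ := h t i ht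
  filter_upwards [hv] with s hs using ⟨hs.1, hs.2.1, hs.2.2.1.differentiableAt⟩

theorem IsLeafGeodesic.deriv_eq {γ : ℝ → M} (h : 𝔐.IsLeafGeodesic γ) {i : Fin ν} {t : ℝ}
    (ht : γ t ∈ (𝔐.chart i).source) :
    ∃ a : E n, HasDerivAt (deriv fun r => 𝔐.hor i (γ r)) a t ∧
      𝔐.g i (𝔐.hor i (γ t), 𝔐.trans i (γ t)) a = 𝔐.geodesicForm i (𝔐.trans i (γ t))
        (𝔐.hor i (γ t), deriv (fun r => 𝔐.hor i (γ r)) t) := by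
  obtain ⟨v, hv⟩ := h t i ht
  have hvd : (deriv fun r => 𝔐.hor i (γ r)) =ᶠ[𝓝 t] v := by
    filter_upwards [hv] with s hs using hs.2.2.1.deriv
  obtain ⟨-, -, -, a, ha, heq⟩ := hv.self_of_nhds
  refine ⟨a, ha.congr_of_eventuallyEq hvd, ?_⟩
  ext b
  have := heq b
  rw [← hvd.self_of_nhds] at this
  simp only [geodesicForm, _root_.sub_apply, _root_.smul_apply, ContinuousLinearMap.flip_apply,
    smul_eq_mul]
  change 𝔐.g i (𝔐.hor i (γ t), 𝔐.trans i (γ t)) a b + _ - _ = 0 at this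
  linarith

/-- The horizontal coordinate of a geodesic, with its velocity, is an integral curve of the spray. -/
theorem IsLeafGeodesic.hasDerivAt_spray {γ : ℝ → M} (h : 𝔐.IsLeafGeodesic γ) {i : Fin ν} {t : ℝ}
    (ht : γ t ∈ (𝔐.chart i).source) :
    HasDerivAt (fun s => (𝔐.hor i (γ s), deriv (fun r => 𝔐.hor i (γ r)) s))
      (𝔐.spray i (𝔐.trans i (γ t)) (𝔐.hor i (γ t), deriv (fun r => 𝔐.hor i (γ r)) t)) t := by
  obtain ⟨a, ha, heq⟩ := h.deriv_eq ht
  obtain ⟨e, he⟩ := exists_equiv_g (mem_target ht)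
  have ha' : a = (𝔐.spray i (𝔐.trans i (γ t))
      (𝔐.hor i (γ t), deriv (fun r => 𝔐.hor i (γ r)) t)).2 := by
    simp only [spray]
    rw [← heq, ← he, ContinuousLinearMap.inverse_equiv]
    simp
  have := (h.eventually ht).self_of_nhds.2.2.hasDerivAt.prodMk ha
  rw [ha'] at this
  exact this

theorem IsLeafGeodesic.continuous {γ : ℝ → M} (h : 𝔐.IsLeafGeodesic γ) : Continuous γ := by
  rw [continuous_iff_continuousAt]
  intro t
  obtain ⟨i, hi, -⟩ := 𝔐.cover (γ t)
  have hev := h.eventually hi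
  have h1 : ContinuousAt (fun s => (𝔐.chart i).symm (𝔐.hor i (γ s), 𝔐.trans i (γ t))) t := by
    have h2 := (𝔐.chart i).continuousAt_symm (mem_target hi)
    have h3 : ContinuousAt (fun s => (𝔐.hor i (γ s), 𝔐.trans i (γ t))) t :=
      hev.self_of_nhds.2.2.continuousAt.prodMk continuousAt_const
    exact ContinuousAt.comp (f := fun s => (𝔐.hor i (γ s), 𝔐.trans i (γ t))) h2 h3
  refine h1.congr ?_
  filter_upwards [hev] with s hs
  rw [← hs.2.1, symm_hor_trans hs.1]

/-- Together with their velocities, both curves are integral curves of the same locally Lipschitz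
spray with the same value at `t`; their transverse coordinates are locally constant. -/
theorem IsLeafGeodesic.eventuallyEq {γ γ' : ℝ → M} (h : 𝔐.IsLeafGeodesic γ)
    (h' : 𝔐.IsLeafGeodesic γ') {i : Fin ν} {t : ℝ} (ht : γ t ∈ (𝔐.chart i).source)
    (heq : γ t = γ' t)
    (hd : deriv (fun r => 𝔐.hor i (γ r)) t = deriv (fun r => 𝔐.hor i (γ' r)) t) :
    γ =ᶠ[𝓝 t] γ' := by
  have ht' : γ' t ∈ (𝔐.chart i).source := heq ▸ ht
  set w := 𝔐.trans i (γ t) with hw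
  obtain ⟨K, U, hU, hK⟩ := (contDiffAt_spray (q := (𝔐.hor i (γ t),
    deriv (fun r => 𝔐.hor i (γ r)) t)) (mem_target ht)).exists_lipschitzOnWith
  have key : ∀ {σ : ℝ → M}, 𝔐.IsLeafGeodesic σ → σ t = γ t →
      deriv (fun r => 𝔐.hor i (σ r)) t = deriv (fun r => 𝔐.hor i (γ r)) t → ∀ᶠ s in 𝓝 t,
      HasDerivAt (fun s => (𝔐.hor i (σ s), deriv (fun r => 𝔐.hor i (σ r)) s))
        (𝔐.spray i w (𝔐.hor i (σ s), deriv (fun r => 𝔐.hor i (σ r)) s)) s ∧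
      (𝔐.hor i (σ s), deriv (fun r => 𝔐.hor i (σ r)) s) ∈ U := by
    intro σ hσ hσt hσd
    have hs : σ t ∈ (𝔐.chart i).source := hσt ▸ ht
    have hc := (hσ.hasDerivAt_spray hs).continuousAt
    have hmem : ∀ᶠ s in 𝓝 t, (𝔐.hor i (σ s), deriv (fun r => 𝔐.hor i (σ r)) s) ∈ U :=
      hc.eventually_mem (by rw [hσt, hσd]; exact hU)
    filter_upwards [hmem, hσ.eventually hs] with s h1 h2
    refine ⟨?_, h1⟩
    have := hσ.hasDerivAt_spray h2.1
    rwa [h2.2.1, hσt] at this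
  have huniq := ODE_solution_unique_of_eventually (v := fun _ => 𝔐.spray i w) (s := fun _ => U)
    (K := K) (t₀ := t) (.of_forall fun _ => hK) (key h rfl rfl) (key h' heq.symm hd.symm)
    (by rw [hd, heq])
  filter_upwards [huniq, h.eventually ht, h'.eventually ht'] with s h1 h2 h3
  refine eq_of_hor_trans h2.1 h3.1 ((Prod.ext_iff.1 h1).1) ?_
  rw [h2.2.1, h3.2.1, heq]

/-- A leafwise geodesic is determined by its initial velocity. -/
theorem IsLeafGeodesic.eq {γ γ' : ℝ → M} (h : 𝔐.IsLeafGeodesic γ)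
    (h' : 𝔐.IsLeafGeodesic γ') {i : Fin ν} {t : ℝ} (ht : γ t ∈ (𝔐.chart i).source)
    (heq : γ t = γ' t)
    (hd : deriv (fun r => 𝔐.hor i (γ r)) t = deriv (fun r => 𝔐.hor i (γ' r)) t) :
    γ = γ' := by
  have hopen : IsOpen {s | γ =ᶠ[𝓝 s] γ'} := by
    rw [isOpen_iff_mem_nhds]
    intro s hs
    exact hs.eventuallyEq_nhds
  have hclosed : IsClosed {s | γ =ᶠ[𝓝 s] γ'} := by
    rw [isClosed_iff_frequently]
    intro s hs
    have hγ : γ s = γ' s := by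
      have hcl : IsClosed {s | γ s = γ' s} := isClosed_eq h.continuous h'.continuous
      rw [isClosed_iff_frequently] at hcl
      exact hcl s (hs.mono fun r hr => hr.self_of_nhds)
    obtain ⟨j, hj, -⟩ := 𝔐.cover (γ s)
    have hj' : γ' s ∈ (𝔐.chart j).source := hγ ▸ hj
    refine h.eventuallyEq h' hj hγ ?_
    have c1 := continuous_snd.continuousAt.comp (h.hasDerivAt_spray hj).continuousAt
    have c2 := continuous_snd.continuousAt.comp (h'.hasDerivAt_spray hj').continuousAt
    -- Velocities that differ at `s` differ nearby by continuity, although `γ` and `γ'` agree near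
    -- points arbitrarily close to `s`.
    by_contra hne
    refine hs ?_
    filter_upwards [c1.ne_iff_eventually_ne c2 |>.1 hne] with r hr hr'
    exact hr ((hr'.fun_comp (𝔐.hor j)).deriv_eq)
  have huniv := IsClopen.eq_univ ⟨hclosed, hopen⟩ ⟨t, h.eventuallyEq h' ht heq hd⟩
  funext s
  have : s ∈ {s | γ =ᶠ[𝓝 s] γ'} := huniv ▸ mem_univ s
  exact this.self_of_nhds

/-! ### Reparametrization and change of charts -/

theorem IsLeafGeodesic.comp_mul {γ : ℝ → M} (h : 𝔐.IsLeafGeodesic γ) (k : ℝ) :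
    𝔐.IsLeafGeodesic fun t => γ (k * t) := by
  intro t i ht
  obtain ⟨v, hv⟩ := h (k * t) i ht
  refine ⟨fun s => k • v (k * s), ?_⟩
  have hk : Tendsto (fun s : ℝ => k * s) (𝓝 t) (𝓝 (k * t)) :=
    (continuous_const_mul k).continuousAt
  have hmul : ∀ s : ℝ, HasDerivAt (fun s : ℝ => k * s) k s := fun s => by
    simpa using (hasDerivAt_id s).const_mul k
  filter_upwards [hk.eventually hv] with s hs
  obtain ⟨h1, h2, h3, a, ha, heq⟩ := hs
  refine ⟨h1, h2, h3.scomp s (hmul s), k • k • a, ?_, fun b => ?_⟩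
  · exact (ha.scomp s (hmul s)).const_smul k
  · have := heq b
    simp only [map_smul, _root_.smul_apply, smul_eq_mul]
    linear_combination k ^ 2 * this

theorem StartsWith.deriv {γ : ℝ → M} {i : Fin ν} {x : M} {v : E n} (h : 𝔐.StartsWith γ i x v) :
    deriv (fun r => 𝔐.hor i (γ r)) 0 = v :=
  h.2.2.2.deriv

theorem StartsWith.unique {γ γ' : ℝ → M} {i : Fin ν} {x : M} {v : E n}
    (h : 𝔐.StartsWith γ i x v) (h' : 𝔐.StartsWith γ' i x v) : γ = γ' :=
  h.1.eq h'.1 (h.2.1.symm ▸ h.2.2.1) (h.2.1.trans h'.2.1.symm) (h.deriv.trans h'.deriv.symm)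

theorem StartsWith.leafExp {γ : ℝ → M} {i : Fin ν} {x : M} {v : E n}
    (h : 𝔐.StartsWith γ i x v) : 𝔐.leafExp i x v = γ 1 := by
  have hex : ∃ γ : ℝ → M, 𝔐.StartsWith γ i x v := ⟨γ, h⟩
  unfold MatchboxManifold.leafExp
  rw [dif_pos hex, hex.choose_spec.unique h]

theorem StartsWith.comp_mul {γ : ℝ → M} {i : Fin ν} {x : M} {v : E n}
    (h : 𝔐.StartsWith γ i x v) (k : ℝ) : 𝔐.StartsWith (fun t => γ (k * t)) i x (k • v) := by
  refine ⟨h.1.comp_mul k, by simpa using h.2.1, h.2.2.1, ?_⟩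
  have hmul : HasDerivAt (fun s : ℝ => k * s) k 0 := by simpa using (hasDerivAt_id (0 : ℝ)).const_mul k
  have h3 := h.2.2.2
  rw [← mul_zero k] at h3
  exact h3.scomp 0 hmul

theorem StartsWith.leafExp_smul {γ : ℝ → M} {i : Fin ν} {x : M} {v : E n}
    (h : 𝔐.StartsWith γ i x v) (k : ℝ) : 𝔐.leafExp i x (k • v) = γ k := by
  rw [(h.comp_mul k).leafExp, mul_one]

/-- A shortest geodesic may be presented in any chart. The derivative of the transition map carries
one velocity to the other, and by `g_compat` it is an isometry. -/
theorem StartsWith.change_chart {γ : ℝ → M} {i j : Fin ν} {x : M} {v : E n}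
    (h : 𝔐.StartsWith γ j x v) (hx : x ∈ (𝔐.chart i).source) :
    ∃ v' : E n, 𝔐.StartsWith γ i x v' ∧
      𝔐.g i (𝔐.chart i x) v' v' = 𝔐.g j (𝔐.chart j x) v v := by
  obtain ⟨hγ, h0, hj, hv⟩ := h
  have hi0 : γ 0 ∈ (𝔐.chart i).source := h0.symm ▸ hx
  have hj0 : γ 0 ∈ (𝔐.chart j).source := h0.symm ▸ hj
  obtain ⟨-, -, hdi⟩ := (hγ.eventually hi0).self_of_nhds
  refine ⟨_, ⟨hγ, h0, hx, hdi.hasDerivAt⟩, ?_⟩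
  have hmem : 𝔐.chart i x ∈ ((𝔐.chart i).symm.trans (𝔐.chart j)).source := by
    rw [OpenPartialHomeomorph.trans_source, OpenPartialHomeomorph.symm_source]
    refine ⟨(𝔐.chart i).map_source hx, ?_⟩
    rw [mem_preimage, (𝔐.chart i).left_inv hx]
    exact hj
  have hdiff := ((𝔐.smooth_transition i j).1 _ hmem).differentiableAt (by simp)
  have hcomp : HasDerivAt (fun r => 𝔐.hor j (γ r))
      (fderiv ℝ (fun u => (𝔐.chart j ((𝔐.chart i).symm (u, (𝔐.chart i x).2))).1) (𝔐.chart i x).1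
        (_root_.deriv (fun r => 𝔐.hor i (γ r)) 0)) 0 := by
    have hx1 : (𝔐.chart i x).1 = 𝔐.hor i (γ 0) := by rw [h0]; rfl
    have h1 := hdiff.hasFDerivAt
    rw [hx1] at h1 ⊢
    refine (HasFDerivAt.comp_hasDerivAt (f := fun r => 𝔐.hor i (γ r)) (0 : ℝ) h1
      hdi.hasDerivAt).congr_of_eventuallyEq ?_
    filter_upwards [hγ.eventually hi0] with s hs
    have : (𝔐.chart i x).2 = 𝔐.trans i (γ s) := by rw [hs.2.1, h0]; rfl
    simp only [Function.comp_apply]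
    rw [this, symm_hor_trans hs.1]
    rfl
  have hcompat := 𝔐.g_compat i j _ hmem (_root_.deriv (fun r => 𝔐.hor i (γ r)) 0)
    (_root_.deriv (fun r => 𝔐.hor i (γ r)) 0)
  rw [hcompat, hcomp.unique hv, (𝔐.chart i).left_inv hx]

/-! ### Speed and length of geodesics -/

/-- Paired with the velocity `v`, the geodesic equation reads `g(a, v) = -(1/2) (D_v g)(v, v)`, so
the derivative `(D_v g)(v, v) + 2 g(a, v)` of the energy vanishes. -/
theorem IsLeafGeodesic.hasDerivAt_energy {γ : ℝ → M} (h : 𝔐.IsLeafGeodesic γ) {i : Fin ν} {w : X}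
    {t : ℝ} (ht : γ t ∈ (𝔐.chart i).source) (hw : 𝔐.trans i (γ t) = w) :
    HasDerivAt (fun s => 𝔐.g i (𝔐.hor i (γ s), w) (deriv (fun r => 𝔐.hor i (γ r)) s)
      (deriv (fun r => 𝔐.hor i (γ r)) s)) 0 t := by
  subst hw
  obtain ⟨a, ha, heq⟩ := h.deriv_eq ht
  obtain ⟨-, -, hc⟩ := (h.eventually ht).self_of_nhds
  have hg := ((contDiffAt_g (mem_target ht)).differentiableAt (by simp)).hasFDerivAt
  have hgc := HasFDerivAt.comp_hasDerivAt (f := fun r => 𝔐.hor i (γ r)) t hg hc.hasDerivAt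
  have := (hgc.clm_apply ha).clm_apply ha
  refine this.congr_deriv ?_
  set v := deriv (fun r => 𝔐.hor i (γ r)) t
  have h1 := DFunLike.congr_fun heq v
  simp only [geodesicForm, _root_.sub_apply, _root_.smul_apply, ContinuousLinearMap.flip_apply,
    smul_eq_mul] at h1
  simp only [Function.comp_apply, _root_.add_apply]
  rw [𝔐.g_symm i _ (mem_target ht) v a, h1]
  ring

/-! ### Shortest geodesic segments -/

theorem StronglyConvex.exists_startsWith {S : Set M} (hS : 𝔐.StronglyConvex S) {p q : M}
    (hp : p ∈ S) (hq : q ∈ S) {i : Fin ν} (hi : p ∈ (𝔐.chart i).source) :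
    ∃ γ v, 𝔐.StartsWith γ i p v ∧ γ 1 = q ∧ (∀ t ∈ Icc (0 : ℝ) 1, γ t ∈ S) ∧
      𝔐.leafDist p q = ENNReal.ofReal (Real.sqrt (𝔐.g i (𝔐.chart i p) v v)) := by
  obtain ⟨γ, ⟨h1, j, v, hv, hd⟩, hmem, -⟩ := hS p hp q hq
  obtain ⟨v', hv', hg⟩ := hv.change_chart hi
  exact ⟨γ, v', hv', h1, hmem, by rw [hg, hd]⟩

theorem mem_leafDisk_self (x : M) (r : ℝ) : x ∈ 𝔐.leafDisk x r := by
  simp [leafDisk, leafDist_self]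

theorem IsConvexityScale.exists_leafExp {lF : ℝ} (h : 𝔐.IsConvexityScale lF) {i : Fin ν} {p q : M}
    (hp : p ∈ (𝔐.chart i).source) (hq : 𝔐.leafDist p q ≤ ENNReal.ofReal lF) :
    ∃ v, 𝔐.leafExp i p v = q ∧
      𝔐.leafDist p q = ENNReal.ofReal (Real.sqrt (𝔐.g i (𝔐.chart i p) v v)) := by
  obtain ⟨γ, v, hv, h1, -, hd⟩ := (h.2.1 p lF h.1 le_rfl).exists_startsWith
    (mem_leafDisk_self p lF) hq hp
  exact ⟨v, hv.leafExp.trans h1, hd⟩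

theorem mem_source_of_mem_plaque {i : Fin ν} {w : X} {z : M} (hz : z ∈ 𝔐.plaque i w) :
    z ∈ (𝔐.chart i).source := hz.1.1

theorem chart_of_mem_plaque {i : Fin ν} {w : X} {z : M} (hz : z ∈ 𝔐.plaque i w) :
    𝔐.chart i z = (𝔐.hor i z, w) := Prod.ext rfl hz.2

theorem mem_T_of_mem_plaque {i : Fin ν} {w : X} {z : M} (hz : z ∈ 𝔐.plaque i w) : w ∈ 𝔐.T i := by
  have := mem_target (mem_source_of_mem_plaque hz)
  rw [hz.2] at this
  exact (mem_target_iff.1 this).2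

theorem symm_hor_of_mem_plaque {i : Fin ν} {w : X} {z : M} (hz : z ∈ 𝔐.plaque i w) :
    (𝔐.chart i).symm (𝔐.hor i z, w) = z := by
  rw [← chart_of_mem_plaque hz, (𝔐.chart i).left_inv (mem_source_of_mem_plaque hz)]

theorem IsLeafGeodesic.contDiffAt_hor {γ : ℝ → M} (h : 𝔐.IsLeafGeodesic γ) {i : Fin ν} {t : ℝ}
    (ht : γ t ∈ (𝔐.chart i).source) : ContDiffAt ℝ 1 (fun r => 𝔐.hor i (γ r)) t := by
  obtain ⟨u, hu, hmem⟩ := (h.eventually ht).exists_mem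
  rw [contDiffAt_one_iff]
  refine ⟨fun s => ContinuousLinearMap.toSpanSingleton ℝ (deriv (fun r => 𝔐.hor i (γ r)) s), u, hu,
    fun s hs => ?_, fun s hs => ?_⟩
  · obtain ⟨a, ha, -⟩ := h.deriv_eq (hmem s hs).1
    exact ((ContinuousLinearMap.toSpanSingletonCLE (𝕜 := ℝ) (E := E n)).continuous.continuousAt.comp
      ha.continuousAt).continuousWithinAt
  · exact (hmem s hs).2.2.hasDerivAt.hasFDerivAt

/-- `γ` is a geodesic, whose restriction to `[0, 1]` lies in the plaque over `w` and has constant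
speed `l`. -/
structure IsPlaqueGeodesic (𝔐 : MatchboxManifold n ν M X) (i : Fin ν) (w : X) (γ : ℝ → M) (l : ℝ) :
    Prop where
  geodesic : 𝔐.IsLeafGeodesic γ
  mem : ∀ t ∈ Icc (0 : ℝ) 1, γ t ∈ 𝔐.plaque i w
  speed : ∀ t ∈ Icc (0 : ℝ) 1, 𝔐.g i (𝔐.hor i (γ t), w) (deriv (fun r => 𝔐.hor i (γ r)) t)
      (deriv (fun r => 𝔐.hor i (γ r)) t) = l ^ 2
  nonneg : 0 ≤ l

theorem StartsWith.isPlaqueGeodesic {γ : ℝ → M} {i : Fin ν} {p : M} {v : E n} {w : X}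
    (h : 𝔐.StartsWith γ i p v) (hmem : ∀ t ∈ Icc (0 : ℝ) 1, γ t ∈ 𝔐.plaque i w) :
    𝔐.IsPlaqueGeodesic i w γ (Real.sqrt (𝔐.g i (𝔐.chart i p) v v)) where
  geodesic := h.1
  mem := hmem
  nonneg := Real.sqrt_nonneg _
  speed := by
    rw [Real.sq_sqrt (g_self_nonneg ((𝔐.chart i).map_source h.2.2.1) v)]
    have hE : ∀ t ∈ Icc (0 : ℝ) 1, HasDerivAt (fun s => 𝔐.g i (𝔐.hor i (γ s), w)
        (_root_.deriv (fun r => 𝔐.hor i (γ r)) s) (_root_.deriv (fun r => 𝔐.hor i (γ r)) s)) 0 t :=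
      fun t ht => h.1.hasDerivAt_energy (mem_source_of_mem_plaque (hmem t ht)) (hmem t ht).2
    intro t ht
    have := constant_of_has_deriv_right_zero (a := (0 : ℝ)) (b := 1)
      (fun t ht => (hE t ht).continuousAt.continuousWithinAt)
      (fun t ht => (hE t (Ico_subset_Icc_self ht)).hasDerivWithinAt) t ht
    rw [this, h.deriv, h.2.1]
    have h0 := hmem 0 (left_mem_Icc.2 zero_le_one)
    rw [h.2.1] at h0
    rw [chart_of_mem_plaque h0]

theorem IsPlaqueGeodesic.hasDerivAt {γ : ℝ → M} {i : Fin ν} {w : X} {l : ℝ}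
    (h : 𝔐.IsPlaqueGeodesic i w γ l) {t : ℝ} (ht : t ∈ Icc (0 : ℝ) 1) :
    HasDerivAt (fun r => 𝔐.hor i (γ r)) (deriv (fun r => 𝔐.hor i (γ r)) t) t :=
  (h.geodesic.eventually (mem_source_of_mem_plaque (h.mem t ht))).self_of_nhds.2.2.hasDerivAt

theorem IsPlaqueGeodesic.leafDist_le {γ : ℝ → M} {i : Fin ν} {w : X} {l : ℝ}
    (h : 𝔐.IsPlaqueGeodesic i w γ l) {s t : ℝ} (hs : s ∈ Icc (0 : ℝ) 1) (ht : t ∈ Icc (0 : ℝ) 1)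
    (hst : s ≤ t) : 𝔐.leafDist (γ s) (γ t) ≤ ENNReal.ofReal ((t - s) * l) := by
  set φ : ℝ → ℝ := fun τ => s + τ * (t - s) with hφ
  have hmaps : ∀ τ ∈ Icc (0 : ℝ) 1, φ τ ∈ Icc (0 : ℝ) 1 := by
    intro τ hτ
    simp only [hφ, mem_Icc] at *
    constructor <;> nlinarith
  have hφd : ∀ τ, HasDerivAt φ (t - s) τ := fun τ => by
    have := ((hasDerivAt_id τ).mul_const (t - s)).const_add s
    rwa [one_mul] at this
  have h0 : φ 0 = s := by simp [hφ]
  have h1 : φ 1 = t := by simp [hφ]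
  have key := leafDist_arc_le (𝔐 := 𝔐) (i := i) (w := w) (c := fun τ => 𝔐.hor i (γ (φ τ)))
    (K := (t - s) * l) (mem_T_of_mem_plaque (h.mem s hs)) ?_ ?_ ?_
  · simp only [h0, h1] at key
    rwa [symm_hor_of_mem_plaque (h.mem s hs), symm_hor_of_mem_plaque (h.mem t ht)] at key
  · intro τ hτ
    have hc := h.geodesic.contDiffAt_hor (mem_source_of_mem_plaque (h.mem _ (hmaps τ hτ)))
    have hφc : ContDiffAt ℝ 1 φ τ := by simp only [hφ]; fun_prop
    exact (hc.comp τ hφc).contDiffWithinAt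
  · intro τ hτ k
    exact ((h.mem _ (hmaps τ hτ)).1.2 k).trans_lt one_lt_two
  · intro τ hτ
    have hτ' := hmaps τ (Ioo_subset_Icc_self hτ)
    have hd : deriv (fun τ => 𝔐.hor i (γ (φ τ))) τ =
        (t - s) • deriv (fun r => 𝔐.hor i (γ r)) (φ τ) :=
      ((h.hasDerivAt hτ').scomp τ (hφd τ)).deriv
    rw [hd]
    simp only [map_smul, _root_.smul_apply, smul_eq_mul]
    rw [h.speed _ hτ', show (t - s) * ((t - s) * l ^ 2) = ((t - s) * l) ^ 2 by ring,
      Real.sqrt_sq (mul_nonneg (sub_nonneg.2 hst) h.nonneg)]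

/-- Two points of a strongly convex subset of a plaque are joined by a geodesic in the set, whose
speed is their distance. -/
theorem StronglyConvex.exists_isPlaqueGeodesic {S : Set M} (hS : 𝔐.StronglyConvex S) {i : Fin ν}
    {w : X} (hSw : S ⊆ 𝔐.plaque i w) {p q : M} (hp : p ∈ S) (hq : q ∈ S) :
    ∃ γ l v, 𝔐.IsPlaqueGeodesic i w γ l ∧ 𝔐.StartsWith γ i p v ∧ 𝔐.g i (𝔐.chart i p) v v = l ^ 2 ∧
      γ 1 = q ∧ (∀ t ∈ Icc (0 : ℝ) 1, γ t ∈ S) ∧ 𝔐.leafDist p q = ENNReal.ofReal l := by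
  obtain ⟨γ, v, hv, h1, hmem, hd⟩ := hS.exists_startsWith hp hq (mem_source_of_mem_plaque (hSw hp))
  refine ⟨γ, _, v, hv.isPlaqueGeodesic fun t ht => hSw (hmem t ht), hv, ?_, h1, hmem, hd⟩
  rw [Real.sq_sqrt (g_self_nonneg ((𝔐.chart i).map_source hv.2.2.1) v)]

/-! ### Frames -/

/-- The linear map from Euclidean space to the tangent space that is given by a frame. -/
noncomputable def frameMap (u : Fin n → E n) : E n →ₗ[ℝ] E n where
  toFun a := ∑ j, a j • u j
  map_add' a b := by simp [add_smul, Finset.sum_add_distrib]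
  map_smul' k a := by simp [mul_smul, Finset.smul_sum]

theorem frameMap_apply (u : Fin n → E n) (a : E n) : frameMap u a = ∑ j, a j • u j := rfl

theorem bilin_frameMap (G : E n →L[ℝ] E n →L[ℝ] ℝ) (u : Fin n → E n) (a b : E n) :
    G (frameMap u a) (frameMap u b) = ∑ j, ∑ k, a j * b k * G (u j) (u k) := by
  simp only [frameMap_apply, map_sum, map_smul, _root_.sum_apply, _root_.smul_apply, smul_eq_mul,
    Finset.mul_sum]
  rw [Finset.sum_comm]
  refine Finset.sum_congr rfl fun j _ => Finset.sum_congr rfl fun k _ => ?_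
  ring

theorem IsFrame.bilin_frameMap {i : Fin ν} {x : M} {u : Fin n → E n} (h : 𝔐.IsFrame i x u)
    (a b : E n) : 𝔐.g i (𝔐.chart i x) (frameMap u a) (frameMap u b) = inner ℝ a b := by
  rw [MatchboxManifold.bilin_frameMap]
  simp only [h _ _]
  simp [PiLp.inner_apply, mul_comm]

theorem IsFrame.sq_norm {i : Fin ν} {x : M} {u : Fin n → E n} (h : 𝔐.IsFrame i x u) (a : E n) :
    𝔐.g i (𝔐.chart i x) (frameMap u a) (frameMap u a) = ‖a‖ ^ 2 := by
  rw [h.bilin_frameMap, real_inner_self_eq_norm_sq]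

theorem IsFrame.injective {i : Fin ν} {x : M} {u : Fin n → E n} (h : 𝔐.IsFrame i x u) :
    Function.Injective (frameMap u) := by
  rw [← LinearMap.ker_eq_bot, LinearMap.ker_eq_bot']
  intro a ha
  have := h.sq_norm a
  rw [ha] at this
  simpa using this.symm

/-- The identification of Euclidean space and the tangent space by an orthonormal frame. -/
noncomputable def IsFrame.equiv {i : Fin ν} {x : M} {u : Fin n → E n} (h : 𝔐.IsFrame i x u) :
    E n ≃L[ℝ] E n :=
  (LinearEquiv.ofInjectiveEndo (frameMap u) h.injective).toContinuousLinearEquiv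

theorem IsFrame.equiv_apply {i : Fin ν} {x : M} {u : Fin n → E n} (h : 𝔐.IsFrame i x u) (a : E n) :
    h.equiv a = frameMap u a := rfl

theorem IsFrame.sq_norm_symm {i : Fin ν} {x : M} {u : Fin n → E n} (h : 𝔐.IsFrame i x u) (a : E n) :
    𝔐.g i (𝔐.chart i x) a a = ‖h.equiv.symm a‖ ^ 2 := by
  rw [← h.sq_norm, ← h.equiv_apply, ContinuousLinearEquiv.apply_symm_apply]

/-- There are `n ^ 2` terms, with coordinates bounded by the norm; hence the `n ^ 2` in the
entrywise condition on the metric. -/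
theorem abs_sum_sum_le {ε : ℝ} (G : Fin n → Fin n → ℝ) (hG : ∀ j k, |G j k| ≤ ε / (n : ℝ) ^ 2)
    (a : E n) : |∑ j, ∑ k, a j * a k * G j k| ≤ ε * ‖a‖ ^ 2 := by
  have hcoord : ∀ j, |a j| ≤ ‖a‖ := fun j => by
    simpa using PiLp.norm_apply_le a j
  calc |∑ j, ∑ k, a j * a k * G j k| ≤ ∑ j : Fin n, ∑ k : Fin n, ‖a‖ * ‖a‖ * (ε / (n : ℝ) ^ 2) := by
        refine (Finset.abs_sum_le_sum_abs _ _).trans (Finset.sum_le_sum fun j _ => ?_)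
        refine (Finset.abs_sum_le_sum_abs _ _).trans (Finset.sum_le_sum fun k _ => ?_)
        rw [abs_mul, abs_mul]
        gcongr
        · exact hcoord j
        · exact hcoord k
        · exact hG j k
    _ = (n : ℝ) ^ 2 * (‖a‖ ^ 2 * (ε / (n : ℝ) ^ 2)) := by
        simp only [Finset.sum_const, Finset.card_univ, Fintype.card_fin, nsmul_eq_mul]
        ring
    _ ≤ ε * ‖a‖ ^ 2 := by
        rcases Nat.eq_zero_or_pos n with rfl | hn
        · have : a = 0 := Subsingleton.elim _ _
          simp [this]
        · have : (n : ℝ) ≠ 0 := by positivity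
          exact le_of_eq (by field_simp)

theorem geoCoord_eq (i : Fin ν) (x : M) (u : Fin n → E n) (a : E n) :
    𝔐.geoCoord i x u a = 𝔐.leafExp i x (frameMap u a) := rfl

theorem affCoord_eq (i : Fin ν) (x : M) (u : Fin n → E n) (a : E n) :
    𝔐.affCoord i x u a = 𝔐.hor i x + frameMap u a := rfl

/-- In affine coordinates the metric tensor is close to the Euclidean one. -/
theorem ApproxEuclidean.sq_close {ε l : ℝ} {i : Fin ν} {x : M} {u : Fin n → E n}
    (h : 𝔐.ApproxEuclidean ε l i x u) {a : E n} (ha : ‖a‖ ≤ l) (b : E n) :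
    |𝔐.g i (𝔐.affCoord i x u a, 𝔐.trans i x) (frameMap u b) (frameMap u b) - ‖b‖ ^ 2|
      ≤ ε * ‖b‖ ^ 2 := by
  have hb : ‖b‖ ^ 2 = ∑ j, ∑ k, b j * b k * (if j = k then 1 else 0) := by
    rw [EuclideanSpace.norm_sq_eq]
    simp [sq]
  have := abs_sum_sum_le _ (h.metric_close a (mem_closedBall_zero_iff.2 ha)) b
  convert this using 2
  rw [bilin_frameMap, hb]
  simp only [← Finset.sum_sub_distrib, mul_sub]

/-! ### Polar decomposition -/

/-- A positive definite form `G` has an orthonormal frame `v` such that the change of frame from a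
given basis `U` to `v` is positive and symmetric. Hence, if `U` is an isometry up to a factor
`1 ± τ`, then `v` is `τ`-close to `U`. -/
theorem exists_frame_close (G : E n →L[ℝ] E n →L[ℝ] ℝ) (hsymm : ∀ a b, G a b = G b a)
    (hpos : ∀ a, a ≠ 0 → 0 < G a a) (U : E n ≃L[ℝ] E n) :
    ∃ v : Fin n → E n, (∀ j k, G (v j) (v k) = if j = k then 1 else 0) ∧
      ∀ τ, 0 ≤ τ → (∀ a, |Real.sqrt (G (U a) (U a)) - ‖a‖| ≤ τ * ‖a‖) →
        ∀ a, G (U a - frameMap v a) (U a - frameMap v a) ≤ (τ * ‖a‖) ^ 2 := by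
  -- `T` is the operator `Uᵀ G U`; its eigenbasis `e` makes the `U (e k)` orthogonal for `G`.
  let T : E n →ₗ[ℝ] E n :=
    { toFun := fun a => (InnerProductSpace.toDual ℝ (E n)).symm ((G (U a)).comp (U : E n →L[ℝ] E n))
      map_add' := fun a b => by simp
      map_smul' := fun k a => by simp }
  have hT : ∀ a b, inner ℝ (T a) b = G (U a) (U b) := fun a b => by
    simp [T]
  have hTs : T.IsSymmetric := fun a b => by
    rw [hT, real_inner_comm, hT, hsymm]
  have hn : Module.finrank ℝ (E n) = n := by simp
  let e := hTs.eigenvectorBasis hn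
  let μ := hTs.eigenvalues hn
  have hTe : ∀ k, T (e k) = μ k • e k := fun k => hTs.apply_eigenvectorBasis hn k
  have hG : ∀ j k, G (U (e j)) (U (e k)) = if j = k then μ j else 0 := fun j k => by
    rw [← hT, hTe, inner_smul_left, e.inner_eq_ite]
    split_ifs <;> simp
  have hμ : ∀ k, 0 < μ k := fun k => by
    have h1 := hpos (U (e k)) (by simpa using e.toBasis.ne_zero k)
    rwa [hG, if_pos rfl] at h1
  have hs : ∀ k, 0 < Real.sqrt (μ k) := fun k => Real.sqrt_pos.2 (hμ k)
  let f : Fin n → E n := fun k => (Real.sqrt (μ k))⁻¹ • U (e k)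
  have hf : ∀ j k, G (f j) (f k) = if j = k then 1 else 0 := fun j k => by
    simp only [f, map_smul, _root_.smul_apply, smul_eq_mul, hG]
    split_ifs with h
    · subst h
      have := Real.mul_self_sqrt (hμ j).le
      have h0 := (hs j).ne'
      field_simp
      nlinarith
    · simp
  have hsum : ∀ a b : Fin n → ℝ, G (∑ j, a j • f j) (∑ k, b k • f k) = ∑ k, a k * b k := by
    intro a b
    simp only [map_sum, map_smul, _root_.sum_apply, _root_.smul_apply, smul_eq_mul, hf]
    simp [mul_comm]
  -- `V = U T^(-1/2)`, the isometric factor in the polar decomposition of `U`.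
  let V : E n →ₗ[ℝ] E n :=
    { toFun := fun a => ∑ k, inner ℝ (e k) a • f k
      map_add' := fun a b => by simp [inner_add_right, add_smul, Finset.sum_add_distrib]
      map_smul' := fun c a => by simp [inner_smul_right, mul_smul, Finset.smul_sum] }
  have hV : ∀ a, V a = ∑ k, inner ℝ (e k) a • f k := fun a => rfl
  refine ⟨fun j => V (EuclideanSpace.single j 1), fun j k => ?_, ?_⟩
  · simp only [hV, hsum]
    have := e.sum_inner_mul_inner (EuclideanSpace.single j (1 : ℝ)) (EuclideanSpace.single k 1)
    simp only [real_inner_comm (e _) (EuclideanSpace.single j (1 : ℝ))] at this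
    rw [this]
    simp [EuclideanSpace.inner_single_left]
  · intro τ hτ hclose a
    have hfr : frameMap (fun j => V (EuclideanSpace.single j 1)) a = V a := by
      rw [frameMap_apply]
      simp only [← map_smul]
      rw [← map_sum]
      congr 1
      ext k
      simp [Finset.sum_apply, Pi.single_apply]
    have hUa : U a = ∑ k, (inner ℝ (e k) a * Real.sqrt (μ k)) • f k := by
      conv_lhs => rw [← e.sum_repr' a, map_sum]
      refine Finset.sum_congr rfl fun k _ => ?_
      rw [map_smul, mul_smul]
      simp only [f]
      rw [smul_inv_smul₀ (hs k).ne']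
    have hdiff : U a - V a = ∑ k, (inner ℝ (e k) a * (Real.sqrt (μ k) - 1)) • f k := by
      rw [hUa, hV, ← Finset.sum_sub_distrib]
      refine Finset.sum_congr rfl fun k _ => ?_
      rw [← sub_smul]
      ring_nf
    rw [hfr, hdiff, hsum]
    have hsq : ‖a‖ ^ 2 = ∑ k, inner ℝ (e k) a ^ 2 := by
      rw [← e.sum_sq_norm_inner_right a]
      simp
    rw [mul_pow, hsq, Finset.mul_sum]
    -- Both `U` and `V` are diagonal from `e` to `f`, so only `|√μ_k - 1| ≤ τ` is needed, which is
    -- the hypothesis at `e k`.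
    refine Finset.sum_le_sum fun k _ => ?_
    have hk := hclose (e k)
    rw [hG, if_pos rfl, e.norm_eq_one, mul_one] at hk
    have h2 : (Real.sqrt (μ k) - 1) ^ 2 ≤ τ ^ 2 := sq_le_sq' (by linarith [abs_le.1 hk]) (abs_le.1 hk).2
    have h3 := sq_nonneg (inner ℝ (e k) a : ℝ)
    nlinarith

/-- Polar decomposition of the identity serves as orthonormalization. -/
theorem exists_isFrame {i : Fin ν} {x : M} (hx : x ∈ (𝔐.chart i).source) :
    ∃ u, 𝔐.IsFrame i x u := by
  have ht := (𝔐.chart i).map_source hx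
  obtain ⟨v, hv, -⟩ := exists_frame_close (𝔐.g i (𝔐.chart i x)) (𝔐.g_symm i _ ht) (𝔐.g_pos i _ ht)
    (ContinuousLinearEquiv.refl ℝ _)
  exact ⟨v, hv⟩

/-! ### Geodesic coordinates -/

theorem IsConvexityScale.injOn_geoCoord {lF : ℝ} (h : 𝔐.IsConvexityScale lF) {i : Fin ν} {x : M}
    {u : Fin n → E n} (hx : x ∈ (𝔐.chart i).source) (hu : 𝔐.IsFrame i x u) :
    InjOn (𝔐.geoCoord i x u) (Metric.closedBall 0 lF) := by
  intro a ha b hb hab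
  refine hu.injective (h.2.2 i x hx ?_ ?_ hab)
  · rw [mem_ofPred_eq, hu.sq_norm]
    exact pow_le_pow_left₀ (norm_nonneg _) (mem_closedBall_zero_iff.1 ha) 2
  · rw [mem_ofPred_eq, hu.sq_norm]
    exact pow_le_pow_left₀ (norm_nonneg _) (mem_closedBall_zero_iff.1 hb) 2

theorem IsConvexityScale.exists_geoCoord {lF : ℝ} (h : 𝔐.IsConvexityScale lF) {i : Fin ν} {x q : M}
    {u : Fin n → E n} (hx : x ∈ (𝔐.chart i).source) (hu : 𝔐.IsFrame i x u)
    (hq : 𝔐.leafDist x q ≤ ENNReal.ofReal lF) :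
    ∃ a, 𝔐.geoCoord i x u a = q ∧ 𝔐.leafDist x q = ENNReal.ofReal ‖a‖ ∧ ‖a‖ ≤ lF := by
  obtain ⟨v, hv, hd⟩ := h.exists_leafExp hx hq
  have hv2 : 𝔐.g i (𝔐.chart i x) v v = ‖hu.equiv.symm v‖ ^ 2 := hu.sq_norm_symm v
  rw [hv2, Real.sqrt_sq (norm_nonneg _)] at hd
  refine ⟨hu.equiv.symm v, ?_, hd, ?_⟩
  · rw [geoCoord_eq, ← hu.equiv_apply, ContinuousLinearEquiv.apply_symm_apply, hv]
  · rw [hd] at hq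
    exact (ENNReal.ofReal_le_ofReal_iff h.1.le).1 hq

/-- Strong convexity yields some coordinate vector whose norm is the distance; injectivity
identifies it with `a`. No geodesic with initial velocity `a` has to be constructed beforehand. -/
theorem IsConvexityScale.leafDist_geoCoord {lF : ℝ} (h : 𝔐.IsConvexityScale lF) {i : Fin ν} {x : M}
    {u : Fin n → E n} (hx : x ∈ (𝔐.chart i).source) (hu : 𝔐.IsFrame i x u) {a : E n}
    (ha : ‖a‖ ≤ lF) (hd : 𝔐.leafDist x (𝔐.geoCoord i x u a) ≤ ENNReal.ofReal lF) :
    𝔐.leafDist x (𝔐.geoCoord i x u a) = ENNReal.ofReal ‖a‖ := by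
  obtain ⟨b, hb, hbd, hbl⟩ := h.exists_geoCoord hx hu hd
  have := h.injOn_geoCoord hx hu (mem_closedBall_zero_iff.2 hbl) (mem_closedBall_zero_iff.2 ha) hb
  rw [hbd, this]

theorem IsConvexityScale.geoCoordInv_eq {lF : ℝ} (h : 𝔐.IsConvexityScale lF) {i : Fin ν} {x q : M}
    {u : Fin n → E n} (hx : x ∈ (𝔐.chart i).source) (hu : 𝔐.IsFrame i x u) {a : E n}
    (ha : ‖a‖ ≤ lF) (haq : 𝔐.geoCoord i x u a = q) : 𝔐.geoCoordInv lF i x u q = a := by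
  have ha' := mem_closedBall_zero_iff.2 ha
  have hex : ∃ b ∈ Metric.closedBall (0 : E n) lF, 𝔐.geoCoord i x u b = q := ⟨a, ha', haq⟩
  exact h.injOn_geoCoord hx hu (Function.invFunOn_mem hex) ha'
    ((Function.invFunOn_eq hex).trans haq.symm)

/-! ### Comparison of the leafwise distance with affine coordinates -/

/-- The affine segment between two points is not much longer than in Euclidean space. -/
theorem ApproxEuclidean.leafDist_affCoord_le {ε l : ℝ} {i : Fin ν} {x : M} {u : Fin n → E n}
    (h : 𝔐.ApproxEuclidean ε l i x u) (hε : 0 ≤ ε) (hx : x ∈ (𝔐.chart i).source)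
    {a b : E n} (ha : ‖a‖ ≤ l) (hb : ‖b‖ ≤ l) :
    𝔐.leafDist ((𝔐.chart i).symm (𝔐.affCoord i x u a, 𝔐.trans i x))
      ((𝔐.chart i).symm (𝔐.affCoord i x u b, 𝔐.trans i x)) ≤
      ENNReal.ofReal ((1 + ε / 2) * ‖b - a‖) := by
  set c : ℝ → E n := fun t => 𝔐.affCoord i x u (a + t • (b - a)) with hc
  have hball : ∀ t ∈ Icc (0 : ℝ) 1, ‖a + t • (b - a)‖ ≤ l := fun t ht => by
    have := (convex_closedBall (0 : E n) l).add_smul_sub_mem (mem_closedBall_zero_iff.2 ha)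
      (mem_closedBall_zero_iff.2 hb) ht
    exact mem_closedBall_zero_iff.1 this
  have hcd : ∀ t, HasDerivAt c (frameMap u (b - a)) t := fun t => by
    have h1 : c = fun t => 𝔐.hor i x + frameMap u a + t • frameMap u (b - a) := by
      funext t
      simp only [hc, affCoord_eq, map_add, map_smul, add_assoc]
    rw [h1]
    have := ((hasDerivAt_id t).smul_const (frameMap u (b - a))).const_add
      (𝔐.hor i x + frameMap u a)
    rwa [one_smul] at this
  have h0 : c 0 = 𝔐.affCoord i x u a := by simp [hc]
  have h1 : c 1 = 𝔐.affCoord i x u b := by simp [hc]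
  have hT := (mem_target_iff.1 (mem_target hx)).2
  rw [← h0, ← h1]
  refine leafDist_arc_le hT ?_ (fun t ht => ?_) fun t ht => ?_
  · have : c = fun t => 𝔐.hor i x + frameMap u a + t • frameMap u (b - a) := by
      funext t
      simp only [hc, affCoord_eq, map_add, map_smul, add_assoc]
    rw [this]
    fun_prop
  · exact h.mem_box _ (mem_closedBall_zero_iff.2 (hball t ht))
  · rw [(hcd t).deriv]
    -- The factor `1 + ε / 2` bounds `√(1 + ε)`.
    have := (abs_le.1 (h.sq_close (hball t (Ioo_subset_Icc_self ht)) (b - a))).2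
    refine Real.sqrt_le_iff.2 ⟨by positivity, ?_⟩
    have h2 : 0 ≤ ε ^ 2 * ‖b - a‖ ^ 2 := by positivity
    simp only [hc]
    nlinarith

theorem IsFrame.hor_eq {i : Fin ν} {x : M} {u : Fin n → E n} (hu : 𝔐.IsFrame i x u) (z : E n) :
    z = 𝔐.affCoord i x u (hu.equiv.symm (z - 𝔐.hor i x)) := by
  rw [affCoord_eq, ← hu.equiv_apply, ContinuousLinearEquiv.apply_symm_apply]
  abel

theorem ApproxEuclidean.le_sq {ε l : ℝ} {i : Fin ν} {x : M} {u : Fin n → E n}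
    (h : 𝔐.ApproxEuclidean ε l i x u) (hu : 𝔐.IsFrame i x u) {z : E n}
    (hz : ‖hu.equiv.symm (z - 𝔐.hor i x)‖ ≤ l) (b : E n) :
    |𝔐.g i (z, 𝔐.trans i x) b b - ‖hu.equiv.symm b‖ ^ 2| ≤ ε * ‖hu.equiv.symm b‖ ^ 2 := by
  have := h.sq_close hz (hu.equiv.symm b)
  rwa [← hu.hor_eq, ← hu.equiv_apply, ContinuousLinearEquiv.apply_symm_apply] at this

theorem IsFrame.hasDerivAt_symm {i j : Fin ν} {x : M} {u : Fin n → E n} (hu : 𝔐.IsFrame i x u)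
    {γ : ℝ → M} {w : X} {l : ℝ} (h : 𝔐.IsPlaqueGeodesic j w γ l) {t : ℝ} (ht : t ∈ Icc (0 : ℝ) 1)
    (z : E n) : HasDerivAt (fun s => hu.equiv.symm (𝔐.hor j (γ s) - z))
      (hu.equiv.symm (deriv (fun r => 𝔐.hor j (γ r)) t)) t :=
  hu.equiv.symm.hasFDerivAt.comp_hasDerivAt t ((h.hasDerivAt ht).sub_const z)

/-- Here and in the next lemma `l` is the Riemannian and `m` the Euclidean length of a velocity. If
`m ≥ ρ`, then `l ^ 2 ≥ (1 - ε) ρ ^ 2 > ((1 - ε) ρ) ^ 2`. -/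
theorem norm_lt_of_sq {ε ρ l m : ℝ} (hε : 0 < ε) (hε1 : ε < 1 / 2) (hρ : 0 < ρ) (hl0 : 0 ≤ l)
    (hl : l ≤ (1 - ε) * ρ) (hm : |l ^ 2 - m ^ 2| ≤ ε * m ^ 2) : m < ρ := by
  by_contra hcon
  push Not at hcon
  have h1 := (abs_le.1 hm).1
  have h2 : l ^ 2 ≤ ((1 - ε) * ρ) ^ 2 := pow_le_pow_left₀ hl0 hl 2
  have h3 : ρ ^ 2 ≤ m ^ 2 := pow_le_pow_left₀ hρ.le hcon 2
  have h4 : 0 < ρ ^ 2 := by positivity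
  have h5 : 0 < ε * ρ ^ 2 := by positivity
  nlinarith

/-- The factor `1 + 3 / 5 * ε` bounds `(1 - ε)^(-1/2)`, whose first-order term is `ε / 2`. -/
theorem norm_le_of_sq {ε l m : ℝ} (hε : 0 < ε) (hε1 : ε < 1 / 10) (hl0 : 0 ≤ l)
    (hm : |l ^ 2 - m ^ 2| ≤ ε * m ^ 2) : m ≤ (1 + 3 / 5 * ε) * l := by
  have h1 := (abs_le.1 hm).1
  refine le_of_sq_le_sq ?_ (by positivity)
  have h2 : (1 - ε) * m ^ 2 ≤ l ^ 2 := by linarith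
  have h3 : 1 ≤ (1 + 3 / 5 * ε) ^ 2 * (1 - ε) := by nlinarith [mul_pos hε hε, mul_pos (mul_pos hε hε) hε]
  have h4 : 0 ≤ m ^ 2 := sq_nonneg m
  calc m ^ 2 ≤ (1 + 3 / 5 * ε) ^ 2 * (1 - ε) * m ^ 2 := by nlinarith
    _ = (1 + 3 / 5 * ε) ^ 2 * ((1 - ε) * m ^ 2) := by ring
    _ ≤ (1 + 3 / 5 * ε) ^ 2 * l ^ 2 := by gcongr
    _ = _ := by ring

/-- The disk of radius `(1 - ε) ρ` lies in the domain where the metric is controlled. -/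
theorem ApproxEuclidean.norm_symm_le {lF ε ρ : ℝ} (hF : 𝔐.IsConvexityScale lF) {i : Fin ν} {x : M}
    {u : Fin n → E n} (h : 𝔐.ApproxEuclidean ε ρ i x u) (hu : 𝔐.IsFrame i x u) (hε : 0 < ε)
    (hε1 : ε < 1 / 10) (hρ : 0 < ρ) (hρF : ρ ≤ lF)
    (hsub : 𝔐.leafDisk x ρ ⊆ 𝔐.plaque i (𝔐.trans i x)) {q : M}
    (hq : q ∈ 𝔐.leafDisk x ((1 - ε) * ρ)) : ‖hu.equiv.symm (𝔐.hor i q - 𝔐.hor i x)‖ ≤ ρ := by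
  have hle : (1 - ε) * ρ ≤ ρ := by nlinarith
  have hq' : q ∈ 𝔐.leafDisk x ρ := le_trans hq (ENNReal.ofReal_le_ofReal hle)
  obtain ⟨γ, l, v, hγ, hv, -, h1, -, hd⟩ := (hF.2.1 x ρ hρ hρF).exists_isPlaqueGeodesic hsub
    (mem_leafDisk_self x ρ) hq'
  have hl : l ≤ (1 - ε) * ρ := by
    have hq2 : 𝔐.leafDist x q ≤ ENNReal.ofReal ((1 - ε) * ρ) := hq
    rw [hd] at hq2
    exact (ENNReal.ofReal_le_ofReal_iff (by nlinarith)).1 hq2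
  -- The metric is controlled only inside the coordinate ball of radius `ρ`, so the geodesic must be
  -- kept there. It stays below the barrier `ρ * t`: at a contact it is inside the ball, where its
  -- Euclidean speed is less than `ρ`.
  have key := image_norm_le_of_norm_deriv_right_lt_deriv_boundary (a := (0 : ℝ)) (b := 1)
    (f := fun s => hu.equiv.symm (𝔐.hor i (γ s) - 𝔐.hor i x))
    (f' := fun t => hu.equiv.symm (deriv (fun r => 𝔐.hor i (γ r)) t))
    (B := fun t => ρ * t) (B' := fun _ => ρ)
    (fun t ht => (hu.hasDerivAt_symm hγ ht _).continuousAt.continuousWithinAt)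
    (fun t ht => (hu.hasDerivAt_symm hγ (Ico_subset_Icc_self ht) _).hasDerivWithinAt)
    (by simp [hv.2.1]) (fun t => by simpa using (hasDerivAt_id t).const_mul ρ)
    (fun t ht heq => ?_) (right_mem_Icc.2 zero_le_one)
  · simpa [h1] using key
  · have hz : ‖hu.equiv.symm (𝔐.hor i (γ t) - 𝔐.hor i x)‖ ≤ ρ := by
      rw [heq]; nlinarith [ht.1, ht.2]
    have := h.le_sq hu hz (deriv (fun r => 𝔐.hor i (γ r)) t)
    rw [hγ.speed t (Ico_subset_Icc_self ht)] at this
    exact norm_lt_of_sq hε (by linarith) hρ hγ.nonneg hl this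

/-- Affine coordinates are almost Lipschitz with constant one. -/
theorem ApproxEuclidean.norm_symm_sub_le {lF ε ρ : ℝ} (hF : 𝔐.IsConvexityScale lF) {i : Fin ν}
    {x : M} {u : Fin n → E n} (h : 𝔐.ApproxEuclidean ε ρ i x u) (hu : 𝔐.IsFrame i x u) (hε : 0 < ε)
    (hε1 : ε < 1 / 10) (hρ : 0 < ρ) (hρF : ρ ≤ lF)
    (hsub : 𝔐.leafDisk x ρ ⊆ 𝔐.plaque i (𝔐.trans i x)) {p q : M}
    (hp : p ∈ 𝔐.leafDisk x ((1 - ε) * ρ)) (hq : q ∈ 𝔐.leafDisk x ((1 - ε) * ρ)) {s : ℝ}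
    (hs : 0 ≤ s) (hpq : 𝔐.leafDist p q ≤ ENNReal.ofReal s) :
    ‖hu.equiv.symm (𝔐.hor i q - 𝔐.hor i p)‖ ≤ (1 + 3 / 5 * ε) * s := by
  have hle : (1 - ε) * ρ ≤ ρ := by nlinarith
  have hsub' : 𝔐.leafDisk x ((1 - ε) * ρ) ⊆ 𝔐.plaque i (𝔐.trans i x) :=
    fun z hz => hsub (le_trans hz (ENNReal.ofReal_le_ofReal hle))
  -- Convexity of the smaller disk keeps the whole segment where the metric is controlled.
  obtain ⟨γ, l, v, hγ, hv, -, h1, hmem, hd⟩ := (hF.2.1 x ((1 - ε) * ρ) (by nlinarith)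
    (hle.trans hρF)).exists_isPlaqueGeodesic hsub' hp hq
  have hl : l ≤ s := (ENNReal.ofReal_le_ofReal_iff hs).1 (hd ▸ hpq)
  have key := norm_image_sub_le_of_norm_deriv_le_segment_01'
    (f := fun s => hu.equiv.symm (𝔐.hor i (γ s) - 𝔐.hor i p))
    (f' := fun t => hu.equiv.symm (deriv (fun r => 𝔐.hor i (γ r)) t)) (C := (1 + 3 / 5 * ε) * s)
    (fun t ht => (hu.hasDerivAt_symm hγ ht _).hasDerivWithinAt) (fun t ht => ?_)
  · simpa [h1, hv.2.1] using key
  · have ht' := Ico_subset_Icc_self ht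
    have hz := h.norm_symm_le hF hu hε hε1 hρ hρF hsub (hmem t ht')
    have := h.le_sq hu hz (deriv (fun r => 𝔐.hor i (γ r)) t)
    rw [hγ.speed t ht'] at this
    exact (norm_le_of_sq hε hε1 hγ.nonneg this).trans (by gcongr)

/-! ### Disks inside plaques -/

theorem isOpen_box (r : ℝ) : IsOpen (box n r) := by
  simp only [box, ofPred_forall]
  exact isOpen_iInter_of_finite fun k => isOpen_lt (by fun_prop) continuous_const

theorem isCompact_closedBox (r : ℝ) : IsCompact (closedBox n r) := by
  have : closedBox n r = EuclideanSpace.equiv (Fin n) ℝ ⁻¹' (Set.pi univ fun _ => Icc (-r) r) := by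
    ext u
    simp only [closedBox, mem_ofPred_eq, mem_preimage, Set.mem_pi, mem_univ, true_imp_iff, mem_Icc, abs_le]
    rfl
  rw [this]
  exact (EuclideanSpace.equiv (Fin n) ℝ).toHomeomorph.isCompact_preimage.2
    (isCompact_univ_pi fun _ => isCompact_Icc)

theorem closedBox_subset_box : closedBox n 1 ⊆ box n 2 := fun _ hu k => (hu k).trans_lt one_lt_two

theorem symm_mem_plaque {i : Fin ν} {w : X} (hw : w ∈ 𝔐.T i) {u : E n} (hu : u ∈ closedBox n 1) :
    (𝔐.chart i).symm (u, w) ∈ 𝔐.plaque i w ∧ 𝔐.hor i ((𝔐.chart i).symm (u, w)) = u := by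
  have ht : (u, w) ∈ (𝔐.chart i).target := mem_target_iff.2 ⟨closedBox_subset_box hu, hw⟩
  have hr := (𝔐.chart i).right_inv ht
  have hh : 𝔐.hor i ((𝔐.chart i).symm (u, w)) = u := congrArg Prod.fst hr
  exact ⟨⟨⟨(𝔐.chart i).map_target ht, hh.symm ▸ hu⟩, congrArg Prod.snd hr⟩, hh⟩

theorem isClosed_plaque {i : Fin ν} {w : X} (hw : w ∈ 𝔐.T i) : IsClosed (𝔐.plaque i w) := by
  have : 𝔐.plaque i w = (𝔐.chart i).symm '' (closedBox n 1 ×ˢ {w}) := by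
    ext z
    constructor
    · intro hz
      exact ⟨(𝔐.hor i z, w), ⟨hz.1.2, rfl⟩, symm_hor_of_mem_plaque hz⟩
    · rintro ⟨⟨u, w'⟩, ⟨hu, rfl⟩, rfl⟩
      exact (symm_mem_plaque hw hu).1
  rw [this]
  refine (((isCompact_closedBox 1).prod isCompact_singleton).image_of_continuousOn
    ((𝔐.chart i).continuousOn_symm.mono ?_)).isClosed
  rintro ⟨u, w'⟩ ⟨hu, rfl⟩
  exact mem_target_iff.2 ⟨closedBox_subset_box hu, hw⟩

/-- A small disk about a point of a plaque that does not meet the boundary of the plaque lies in the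
plaque. -/
theorem IsConvexityScale.leafDisk_subset_plaque {lF : ℝ} (hF : 𝔐.IsConvexityScale lF) {i : Fin ν}
    {w : X} {p : M} (hp : p ∈ 𝔐.plaque i w) {l : ℝ} (hl : 0 < l) (hlF : l ≤ lF)
    (hint : ∀ q ∈ 𝔐.leafDisk p l, q ∈ 𝔐.plaque i w → 𝔐.hor i q ∈ box n 1) :
    𝔐.leafDisk p l ⊆ 𝔐.plaque i w := by
  intro q hq
  obtain ⟨γ, v, hv, h1, hmem, -⟩ := (hF.2.1 p l hl hlF).exists_startsWith
    (mem_leafDisk_self p l) hq (mem_source_of_mem_plaque hp)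
  -- The times spent in the plaque form a closed set, and by `hint` the segment cannot leave through
  -- the boundary of the cube.
  have hsub : Icc (0 : ℝ) 1 ⊆ γ ⁻¹' 𝔐.plaque i w := by
    refine IsClosed.Icc_subset_of_forall_exists_gt ?_ ?_ ?_
    · exact ((isClosed_plaque (mem_T_of_mem_plaque hp)).preimage hv.1.continuous).inter isClosed_Icc
    · rw [mem_preimage, hv.2.1]; exact hp
    · rintro t ⟨ht, ht01⟩ y hy
      have hbox := hint _ (hmem t (Ico_subset_Icc_self ht01)) ht
      have hev := hv.1.eventually (mem_source_of_mem_plaque ht)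
      have hev2 := hev.self_of_nhds.2.2.continuousAt.eventually_mem ((isOpen_box 1).mem_nhds hbox)
      have hall : ∀ᶠ s in 𝓝[>] t, s ∈ γ ⁻¹' 𝔐.plaque i w := by
        refine nhdsWithin_le_nhds ?_
        filter_upwards [hev, hev2] with s hs hs2
        exact ⟨⟨hs.1, fun k => (hs2 k).le⟩, hs.2.1.trans ht.2⟩
      exact (hall.and (Ioc_mem_nhdsGT hy)).exists
  have := hsub (right_mem_Icc.2 zero_le_one)
  rwa [mem_preimage, h1] at this

theorem transport_mem_plaque {i : Fin ν} {w : X} {x' z : M} (hx' : x' ∈ 𝔐.closedFlowBox i)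
    (hz : z ∈ 𝔐.plaque i w) : 𝔐.transport i x' z ∈ 𝔐.plaque i (𝔐.trans i x') ∧
      𝔐.hor i (𝔐.transport i x' z) = 𝔐.hor i z :=
  symm_mem_plaque (mem_target_iff.1 (mem_target hx'.1)).2 hz.1.2

theorem transport_transport {i : Fin ν} {x x' z : M} (hx : x ∈ 𝔐.closedFlowBox i) (hz : z ∈ 𝔐.plaque i (𝔐.trans i x')) :
    𝔐.transport i x' (𝔐.transport i x z) = z := by
  unfold transport
  have := (transport_mem_plaque hx hz).2
  rw [transport] at this
  rw [this, symm_hor_of_mem_plaque hz]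

/-- Vertical translation preserves, up to the transverse variation, that a disk lies in a flow
box. -/
theorem IsConvexityScale.leafDisk_transport_subset {lF r κ : ℝ} (hF : 𝔐.IsConvexityScale lF)
    (hvar : 𝔐.VarLE r κ) (hκ : 0 ≤ κ) {i : Fin ν} {x x' p : M} (hx : x ∈ 𝔐.closedFlowBox i)
    (hx' : x' ∈ 𝔐.diskSection i x r) (hp : p ∈ 𝔐.plaque i (𝔐.trans i x)) {ρ l : ℝ}
    (hsub : 𝔐.leafDisk p ρ ⊆ 𝔐.flowBox i) (hl : 0 < l) (hlF : l ≤ lF) (hρ : l + κ ≤ ρ) :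
    𝔐.leafDisk (𝔐.transport i x' p) l ⊆ 𝔐.plaque i (𝔐.trans i x') := by
  refine hF.leafDisk_subset_plaque (transport_mem_plaque hx'.1 hp).1 hl hlF fun q hq hqp => ?_
  have hb := transport_mem_plaque hx hqp
  have h1 := (hvar i x hx x' hx' p hp _ hb.1).1
  rw [transport_transport hx hqp] at h1
  -- Translated back, `q` is within `l + κ ≤ ρ` of `p`, hence in the open flow box, and its
  -- horizontal coordinate is unchanged.
  have h2 : 𝔐.transport i x q ∈ 𝔐.leafDisk p ρ := by
    refine h1.trans ((add_le_add_left hq _).trans ?_)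
    rw [← ENNReal.ofReal_add hl.le hκ]
    exact ENNReal.ofReal_le_ofReal hρ
  exact hb.2 ▸ (hsub h2).2

/-! ### Points in affine coordinates -/

/-- The point of the plaque through `x` with affine coordinates `a`. -/
noncomputable def affPoint (𝔐 : MatchboxManifold n ν M X) (i : Fin ν) (x : M) (u : Fin n → E n)
    (a : E n) : M :=
  (𝔐.chart i).symm (𝔐.affCoord i x u a, 𝔐.trans i x)

theorem affPoint_zero {i : Fin ν} {x : M} (u : Fin n → E n) (hx : x ∈ (𝔐.chart i).source) :
    𝔐.affPoint i x u 0 = x := by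
  rw [affPoint, affCoord_eq, map_zero, add_zero, symm_hor_trans hx]

theorem ApproxEuclidean.hor_affPoint {ε l : ℝ} {i : Fin ν} {x : M} {u : Fin n → E n}
    (h : 𝔐.ApproxEuclidean ε l i x u) (hx : x ∈ (𝔐.chart i).source) {a : E n} (ha : ‖a‖ ≤ l) :
    𝔐.hor i (𝔐.affPoint i x u a) = 𝔐.hor i x + frameMap u a := by
  have ht : (𝔐.affCoord i x u a, 𝔐.trans i x) ∈ (𝔐.chart i).target :=
    mem_target_iff.2 ⟨h.mem_box a (mem_closedBall_zero_iff.2 ha), (mem_target_iff.1 (mem_target hx)).2⟩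
  exact congrArg Prod.fst ((𝔐.chart i).right_inv ht)

theorem ApproxEuclidean.leafDist_affPoint_le {ε l : ℝ} {i : Fin ν} {x : M} {u : Fin n → E n}
    (h : 𝔐.ApproxEuclidean ε l i x u) (hε : 0 ≤ ε) (hx : x ∈ (𝔐.chart i).source)
    {a : E n} (ha : ‖a‖ ≤ l) :
    𝔐.leafDist x (𝔐.affPoint i x u a) ≤ ENNReal.ofReal ((1 + ε / 2) * ‖a‖) := by
  have h0 : ‖(0 : E n)‖ ≤ l := by simpa using (norm_nonneg a).trans ha
  have := h.leafDist_affCoord_le hε hx h0 ha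
  rw [sub_zero] at this
  change 𝔐.leafDist (𝔐.affPoint i x u 0) _ ≤ _ at this
  rwa [affPoint_zero u hx] at this

theorem ApproxEuclidean.symm_hor_affPoint {ε l : ℝ} {i : Fin ν} {x : M} {u : Fin n → E n}
    (h : 𝔐.ApproxEuclidean ε l i x u) (hu : 𝔐.IsFrame i x u) (hx : x ∈ (𝔐.chart i).source)
    {a : E n} (ha : ‖a‖ ≤ l) (p : M) :
    hu.equiv.symm (𝔐.hor i (𝔐.affPoint i x u a) - 𝔐.hor i p)
      = a - hu.equiv.symm (𝔐.hor i p - 𝔐.hor i x) := by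
  rw [h.hor_affPoint hx ha, ← hu.equiv_apply,
    show 𝔐.hor i x + hu.equiv a - 𝔐.hor i p = hu.equiv a - (𝔐.hor i p - 𝔐.hor i x) by abel,
    map_sub, ContinuousLinearEquiv.symm_apply_apply]

theorem VarLE.le_transport {r κ : ℝ} (h : 𝔐.VarLE r κ) (hκ : 0 ≤ κ) {i : Fin ν} {x x' y z : M}
    (hx : x ∈ 𝔐.closedFlowBox i) (hx' : x' ∈ 𝔐.diskSection i x r)
    (hy : y ∈ 𝔐.plaque i (𝔐.trans i x)) (hz : z ∈ 𝔐.plaque i (𝔐.trans i x)) {s t : ℝ} (hs : 0 ≤ s)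
    (hd : 𝔐.leafDist (𝔐.transport i x' y) (𝔐.transport i x' z) ≤ ENNReal.ofReal s)
    (ht : s + κ ≤ t) : 𝔐.leafDist y z ≤ ENNReal.ofReal t := by
  refine ((h i x hx x' hx' y hy z hz).1.trans (add_le_add_left hd _)).trans ?_
  rw [← ENNReal.ofReal_add hs hκ]
  exact ENNReal.ofReal_le_ofReal ht

theorem VarLE.transport_le {r κ : ℝ} (h : 𝔐.VarLE r κ) (hκ : 0 ≤ κ) {i : Fin ν} {x x' y z : M}
    (hx : x ∈ 𝔐.closedFlowBox i) (hx' : x' ∈ 𝔐.diskSection i x r)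
    (hy : y ∈ 𝔐.plaque i (𝔐.trans i x)) (hz : z ∈ 𝔐.plaque i (𝔐.trans i x)) {s t : ℝ} (hs : 0 ≤ s)
    (hd : 𝔐.leafDist y z ≤ ENNReal.ofReal s) (ht : s + κ ≤ t) :
    𝔐.leafDist (𝔐.transport i x' y) (𝔐.transport i x' z) ≤ ENNReal.ofReal t := by
  refine ((h i x hx x' hx' y hy z hz).2.trans (add_le_add_left hd _)).trans ?_
  rw [← ENNReal.ofReal_add hs hκ]
  exact ENNReal.ofReal_le_ofReal ht

theorem transport_self {i : Fin ν} {x x' : M} (hx' : x' ∈ (𝔐.chart i).source)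
    (h : 𝔐.hor i x' = 𝔐.hor i x) : 𝔐.transport i x' x = x' := by
  rw [transport, ← h, symm_hor_trans hx']

/-! ### Comparison of the metric tensors on nearby plaques -/

/-- Small horizontal vectors have almost the same length at `x` and at `x'`, up to an additive
error. -/
theorem norm_symm_le_add_of_small {lF ε ρ rs : ℝ} (hF : 𝔐.IsConvexityScale lF) (hε : 0 < ε)
    (hε1 : ε < 1 / 10) (hρ : 0 < ρ) (hρF : ρ ≤ lF) (hvar : 𝔐.VarLE rs (ε * ρ)) {i : Fin ν}
    {x x' : M} {u u' : Fin n → E n} (hx : x ∈ 𝔐.closedFlowBox i) (hx' : x' ∈ 𝔐.diskSection i x rs)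
    (h : 𝔐.ApproxEuclidean ε ρ i x u) (hu : 𝔐.IsFrame i x u)
    (hsub : 𝔐.leafDisk x ρ ⊆ 𝔐.plaque i (𝔐.trans i x))
    (h' : 𝔐.ApproxEuclidean ε ((1 - ε) * ρ) i x' u') (hu' : 𝔐.IsFrame i x' u')
    (hsub' : 𝔐.leafDisk x' ((1 - ε) * ρ) ⊆ 𝔐.plaque i (𝔐.trans i x')) {b : E n}
    (hb : ‖hu.equiv.symm b‖ ≤ (1 - 3 * ε) * ρ) (hb' : ‖hu'.equiv.symm b‖ ≤ (1 - 3 * ε) * ρ) :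
    ‖hu'.equiv.symm b‖ ≤ (1 + 3 / 5 * ε) * ((1 + ε / 2) * ‖hu.equiv.symm b‖ + ε * ρ) ∧
    ‖hu.equiv.symm b‖ ≤ (1 + 3 / 5 * ε) * ((1 + ε / 2) * ‖hu'.equiv.symm b‖ + ε * ρ) := by
  set c := hu.equiv.symm b with hc
  set c' := hu'.equiv.symm b with hc'
  have hερ : 0 < ε * ρ := by positivity
  have heερ : 0 < ε * (ε * ρ) := by positivity
  have hcb : frameMap u c = b := by rw [← hu.equiv_apply, hc, ContinuousLinearEquiv.apply_symm_apply]
  have hcb' : frameMap u' c' = b := by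
    rw [← hu'.equiv_apply, hc', ContinuousLinearEquiv.apply_symm_apply]
  have hxs := hx.1
  have hxs' := hx'.1.1
  have hcρ : ‖c‖ ≤ ρ := by nlinarith
  have hcρ' : ‖c'‖ ≤ (1 - ε) * ρ := by nlinarith
  have hP := h.leafDist_affPoint_le hε.le hxs hcρ
  have hP' := h'.leafDist_affPoint_le hε.le hxs' hcρ'
  -- The bound `(1 - 3 * ε) * ρ` leaves room for the factor `1 + ε / 2` and, at `x'`, for two
  -- factors `1 - ε`.
  have hPd : 𝔐.affPoint i x u c ∈ 𝔐.leafDisk x ((1 - ε) * ρ) :=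
    hP.trans (ENNReal.ofReal_le_ofReal (by nlinarith))
  have hPd' : 𝔐.affPoint i x' u' c' ∈ 𝔐.leafDisk x' ((1 - ε) * ((1 - ε) * ρ)) :=
    hP'.trans (ENNReal.ofReal_le_ofReal (by nlinarith))
  have hPp : 𝔐.affPoint i x u c ∈ 𝔐.plaque i (𝔐.trans i x) :=
    hsub (le_trans hPd (ENNReal.ofReal_le_ofReal (by nlinarith)))
  have hxp : x ∈ 𝔐.plaque i (𝔐.trans i x) := ⟨hx, rfl⟩
  -- Both points have horizontal coordinate `λ_i(x) + b`.
  have ht : 𝔐.transport i x' (𝔐.affPoint i x u c) = 𝔐.affPoint i x' u' c' := by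
    rw [transport, h.hor_affPoint hxs hcρ, affPoint, affCoord_eq, hcb, hcb', hx'.2.1]
  have htx := transport_self hxs' hx'.2.1
  constructor
  · have hd := hvar.transport_le hερ.le hx hx' hxp hPp (by positivity) hP le_rfl
    rw [ht, htx] at hd
    have := h'.norm_symm_sub_le hF hu' hε hε1 (by nlinarith) (by nlinarith) hsub'
      (mem_leafDisk_self x' _) hPd' (by positivity) hd
    rwa [h'.symm_hor_affPoint hu' hxs' hcρ', sub_self, map_zero, sub_zero] at this
  · have hd := hvar.le_transport hερ.le hx hx' hxp hPp (s := (1 + ε / 2) * ‖c'‖) (by positivity)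
      (by rw [ht, htx]; exact hP') le_rfl
    have := h.norm_symm_sub_le hF hu hε hε1 hρ hρF hsub
      (mem_leafDisk_self x _) hPd (by positivity) hd
    rwa [h.symm_hor_affPoint hu hxs hcρ, sub_self, map_zero, sub_zero] at this

/-- At the length `(1 - 3 * ε) * ρ` the additive error is a relative one. To first order the errors
add up to `3/5 + 1/2 + 1 = 21/10`, and `11/5` absorbs the rest. -/
theorem le_mul_of_le_add {ε ρ c c' : ℝ} (hε : 0 < ε) (hε1 : ε < 1 / 2000)
    (hc : c' = (1 - 3 * ε) * ρ)
    (h : c' ≤ (1 + 3 / 5 * ε) * ((1 + ε / 2) * c + ε * ρ)) (hc0 : 0 ≤ c) (hρ : 0 < ρ) :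
    c' ≤ (1 + 11 / 5 * ε) * c := by
  by_contra hcon
  push Not at hcon
  have h1 : 0 < ε * ρ := by positivity
  have h2 : 0 < ε * (ε * ρ) := by positivity
  have h3 : 0 ≤ ε * c := by positivity
  have h4 : 0 ≤ ε * (ε * c) := by positivity
  have h5 : ε * (ε * c) ≤ ε * c / 2000 := by nlinarith
  have h6 : ε * (ε * ρ) ≤ ε * ρ / 2000 := by nlinarith
  nlinarith

/-- Horizontal vectors have almost the same length at `x` and at `x'`. -/
theorem norm_symm_le_mul {lF ε ρ rs : ℝ} (hF : 𝔐.IsConvexityScale lF) (hε : 0 < ε)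
    (hε1 : ε < 1 / 2000) (hρ : 0 < ρ) (hρF : ρ ≤ lF) (hvar : 𝔐.VarLE rs (ε * ρ)) {i : Fin ν}
    {x x' : M} {u u' : Fin n → E n} (hx : x ∈ 𝔐.closedFlowBox i) (hx' : x' ∈ 𝔐.diskSection i x rs)
    (h : 𝔐.ApproxEuclidean ε ρ i x u) (hu : 𝔐.IsFrame i x u)
    (hsub : 𝔐.leafDisk x ρ ⊆ 𝔐.plaque i (𝔐.trans i x))
    (h' : 𝔐.ApproxEuclidean ε ((1 - ε) * ρ) i x' u') (hu' : 𝔐.IsFrame i x' u')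
    (hsub' : 𝔐.leafDisk x' ((1 - ε) * ρ) ⊆ 𝔐.plaque i (𝔐.trans i x')) (b : E n) :
    ‖hu'.equiv.symm b‖ ≤ (1 + 11 / 5 * ε) * ‖hu.equiv.symm b‖ ∧
    ‖hu.equiv.symm b‖ ≤ (1 + 11 / 5 * ε) * ‖hu'.equiv.symm b‖ := by
  set m := max ‖hu.equiv.symm b‖ ‖hu'.equiv.symm b‖ with hm
  have hcm : ‖hu.equiv.symm b‖ ≤ m := le_max_left _ _
  have hcm' : ‖hu'.equiv.symm b‖ ≤ m := le_max_right _ _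
  rcases (norm_nonneg _ |>.trans hcm).eq_or_lt with h0 | h0
  · have e1 : ‖hu.equiv.symm b‖ = 0 := le_antisymm (hcm.trans h0.symm.le) (norm_nonneg _)
    have e2 : ‖hu'.equiv.symm b‖ = 0 := le_antisymm (hcm'.trans h0.symm.le) (norm_nonneg _)
    simp [e1, e2]
  -- Rescaling makes the larger of the two norms as large as the additive estimate allows; the
  -- inequality in the other direction is then trivial.
  set k := (1 - 3 * ε) * ρ / m with hk
  have hk0 : 0 < k := div_pos (mul_pos (by linarith) hρ) h0
  have hkm : k * m = (1 - 3 * ε) * ρ := div_mul_cancel₀ _ h0.ne'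
  have hn : ‖hu.equiv.symm (k • b)‖ = k * ‖hu.equiv.symm b‖ := by
    rw [map_smul, norm_smul, Real.norm_of_nonneg hk0.le]
  have hn' : ‖hu'.equiv.symm (k • b)‖ = k * ‖hu'.equiv.symm b‖ := by
    rw [map_smul, norm_smul, Real.norm_of_nonneg hk0.le]
  have hsmall := norm_symm_le_add_of_small hF hε (by linarith) hρ hρF hvar hx hx' h hu hsub h' hu'
    hsub' (b := k • b) (by rw [hn, ← hkm]; gcongr) (by rw [hn', ← hkm]; gcongr)
  rw [hn, hn'] at hsmall
  have hone : 0 ≤ 11 / 5 * ε := by positivity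
  rcases le_total ‖hu.equiv.symm b‖ ‖hu'.equiv.symm b‖ with hle | hle
  · have hmx : m = ‖hu'.equiv.symm b‖ := max_eq_right hle
    refine ⟨?_, hle.trans (le_mul_of_one_le_left (norm_nonneg _) (by linarith))⟩
    have := le_mul_of_le_add hε hε1 (hmx ▸ hkm) hsmall.1 (by positivity) hρ
    refine le_of_mul_le_mul_left ?_ hk0
    linarith
  · have hmx : m = ‖hu.equiv.symm b‖ := max_eq_left hle
    refine ⟨hle.trans (le_mul_of_one_le_left (norm_nonneg _) (by linarith)), ?_⟩
    have := le_mul_of_le_add hε hε1 (hmx ▸ hkm) hsmall.2 (by positivity) hρ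
    refine le_of_mul_le_mul_left ?_ hk0
    linarith

/-- Here `c`, `c'` and `l` are the lengths of one vector at `x`, `x'` and `y'`. The constant is
`14/5 = 11/5 + 3/5`. -/
theorem abs_sub_le_of_sq {ε c c' l : ℝ} (hε : 0 < ε) (hε1 : ε < 1 / 2000) (hc : 0 ≤ c)
    (hc' : 0 ≤ c') (hl : 0 ≤ l) (h1 : c' ≤ (1 + 11 / 5 * ε) * c) (h2 : c ≤ (1 + 11 / 5 * ε) * c')
    (h : |l ^ 2 - c' ^ 2| ≤ ε * c' ^ 2) : |l - c| ≤ 14 / 5 * ε * c := by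
  have hlu : l ≤ (1 + ε / 2) * c' := by
    refine le_of_sq_le_sq ?_ (by positivity)
    have := (abs_le.1 h).2
    nlinarith [mul_nonneg (mul_nonneg hε.le hε.le) (sq_nonneg c')]
  have hll := norm_le_of_sq hε (by linarith) hl h
  have hec : 0 ≤ ε * c := by positivity
  have k1 : ε * (ε * c) ≤ ε * c / 2000 := by nlinarith
  rw [abs_le]
  constructor
  · have : c ≤ (1 + 11 / 5 * ε) * ((1 + 3 / 5 * ε) * l) := h2.trans (by gcongr)
    by_contra hcon
    push Not at hcon
    have h3 := mul_lt_mul_of_pos_left (show l < c * (1 - 14 / 5 * ε) by linarith)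
      (show 0 < (1 + 11 / 5 * ε) * (1 + 3 / 5 * ε) by positivity)
    have h4 : 0 ≤ ε * (ε * c) := by positivity
    have h5 : 0 ≤ ε * (ε * (ε * c)) := by positivity
    nlinarith
  · have : l ≤ (1 + ε / 2) * ((1 + 11 / 5 * ε) * c) := hlu.trans (by gcongr)
    nlinarith

/-! ### Nested disks and the frame at `y'` -/

theorem leafDisk_mono {x : M} {r s : ℝ} (h : r ≤ s) : 𝔐.leafDisk x r ⊆ 𝔐.leafDisk x s :=
  fun _ hq => le_trans hq (ENNReal.ofReal_le_ofReal h)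

theorem leafDisk_subset_leafDisk {x y : M} {r s t : ℝ} (hr : 0 ≤ r) (hs : 0 ≤ s)
    (hy : y ∈ 𝔐.leafDisk x r) (h : r + s ≤ t) : 𝔐.leafDisk y s ⊆ 𝔐.leafDisk x t :=
  fun _ hq => leafDist_le_of_le hr hs hy hq h

/-- A frame at `y'` that is close to the frame `u` at `x`. -/
theorem exists_isFrame_close {lF ε ρ rs : ℝ} (hF : 𝔐.IsConvexityScale lF) (hε : 0 < ε)
    (hε1 : ε < 1 / 2000) (hρ : 0 < ρ) (hρF : ρ ≤ lF) (hvar : 𝔐.VarLE rs (ε * ρ)) {i : Fin ν}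
    {x x' y' : M} {u : Fin n → E n} (hx : x ∈ 𝔐.closedFlowBox i) (hx' : x' ∈ 𝔐.diskSection i x rs)
    (h : 𝔐.ApproxEuclidean ε ρ i x u) (hu : 𝔐.IsFrame i x u)
    (hsub : 𝔐.leafDisk x ρ ⊆ 𝔐.plaque i (𝔐.trans i x))
    (h' : ∀ u', 𝔐.IsFrame i x' u' → 𝔐.ApproxEuclidean ε ((1 - ε) * ρ) i x' u')
    (hsub' : 𝔐.leafDisk x' ((1 - ε) * ρ) ⊆ 𝔐.plaque i (𝔐.trans i x'))
    (hy' : y' ∈ 𝔐.leafDisk x' ((1 - ε) * ((1 - ε) * ρ))) :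
    ∃ (v : Fin n → E n) (hv : 𝔐.IsFrame i y' v), ∀ a,
      ‖hv.equiv.symm (hu.equiv a) - a‖ ≤ 14 / 5 * ε * ‖a‖ := by
  obtain ⟨u', hu'⟩ := exists_isFrame (𝔐 := 𝔐) hx'.1.1
  have hA' := h' u' hu'
  have hρ' : 0 < (1 - ε) * ρ := by nlinarith
  have hρ'le : (1 - ε) * ρ ≤ ρ := by nlinarith
  have hyp : y' ∈ 𝔐.plaque i (𝔐.trans i x') := hsub' (leafDisk_mono (by nlinarith) hy')
  have hys := mem_source_of_mem_plaque hyp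
  have htar := (𝔐.chart i).map_source hys
  obtain ⟨v, hv, hclose⟩ := exists_frame_close (𝔐.g i (𝔐.chart i y')) (𝔐.g_symm i _ htar)
    (𝔐.g_pos i _ htar) hu.equiv
  have hvf : 𝔐.IsFrame i y' v := hv
  refine ⟨v, hvf, fun a => ?_⟩
  have key := hclose (14 / 5 * ε) (by positivity) (fun a => ?_) a
  · rw [hvf.sq_norm_symm, map_sub, ← hvf.equiv_apply, ContinuousLinearEquiv.symm_apply_apply] at key
    exact le_of_sq_le_sq key (by positivity)
  · have hmul := norm_symm_le_mul hF hε hε1 hρ hρF hvar hx hx' h hu hsub hA' hu' hsub' (hu.equiv a)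
    rw [ContinuousLinearEquiv.symm_apply_apply] at hmul
    have hz := hA'.norm_symm_le hF hu' hε (by linarith) hρ' (hρ'le.trans hρF) hsub' hy'
    have hsq := hA'.le_sq hu' hz (hu.equiv a)
    rw [← chart_of_mem_plaque hyp, ← Real.sq_sqrt (g_self_nonneg htar (hu.equiv a))] at hsq
    exact abs_sub_le_of_sq hε hε1 (norm_nonneg _) (norm_nonneg _) (Real.sqrt_nonneg _) hmul.1 hmul.2
      hsq

/-! ### The error estimate for the comparison map -/

set_option maxHeartbeats 1000000 in
/-- If the metric tensors at `x` and `y'` are close, with respect to the frames `u` and `v`, then the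
comparison map is close to the identity. -/
theorem comparison_sub_le {lF ε0 rF rs : ℝ} (hlF : 𝔐.IsConvexityScale lF) (hε0 : 0 < ε0)
    (hε0' : ε0 < 1 / 2000) (hr : 0 < rF) (hrlF : rF ≤ lF / 5) (hvar : 𝔐.VarLE rs (ε0 * rF))
    {i : Fin ν} {x x' y : M} {u v : Fin n → E n} (hxcl : x ∈ 𝔐.closedFlowBox i)
    (hconv : 𝔐.StronglyConvex (𝔐.plaque i (𝔐.trans i x'))) (hx' : x' ∈ 𝔐.diskSection i x rs)
    (hsub : 𝔐.leafDisk x rF ⊆ 𝔐.plaque i (𝔐.trans i x)) (hA : 𝔐.ApproxEuclidean ε0 rF i x u)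
    (hu : 𝔐.IsFrame i x u) (hy : y ∈ 𝔐.leafDisk x (rF / 2))
    (hsuby' : 𝔐.leafDisk (𝔐.transport i x' y) ((1 / 2 - ε0) * rF) ⊆
      𝔐.plaque i (𝔐.trans i (𝔐.transport i x' y)))
    (hA' : 𝔐.ApproxEuclidean ε0 ((1 / 2 - ε0) * rF) i (𝔐.transport i x' y) v)
    (hv : 𝔐.IsFrame i (𝔐.transport i x' y) v)
    (hclose : ∀ a, ‖hv.equiv.symm (hu.equiv a) - a‖ ≤ 14 / 5 * ε0 * ‖a‖) {a : E n}
    (ha : ‖a‖ ≤ rF / 2) :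
    𝔐.geoCoord i x u (a + 𝔐.geoCoordInv lF i x u y) ∈ 𝔐.plaque i (𝔐.trans i x) ∧
    𝔐.transport i x' (𝔐.geoCoord i x u (a + 𝔐.geoCoordInv lF i x u y)) ∈
      𝔐.geoCoord i (𝔐.transport i x' y) v '' Metric.closedBall 0 lF ∧
    ‖𝔐.comparison lF i x x' y u v a - a‖ ≤ 20 * (ε0 * rF) := by
  have hlF0 : 0 < lF := hlF.1
  have her : 0 < ε0 * rF := by positivity
  have heer : 0 < ε0 * (ε0 * rF) := by positivity
  have heer' : ε0 * (ε0 * rF) ≤ ε0 * rF / 2000 := by nlinarith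
  have her' : ε0 * rF ≤ rF / 2000 := by nlinarith
  have hyp : y ∈ 𝔐.plaque i (𝔐.trans i x) := hsub (leafDisk_mono (by linarith) hy)
  obtain ⟨hyp', hyhor⟩ := transport_mem_plaque hx'.1 hyp
  set y' := 𝔐.transport i x' y with hy'def
  have hys' := mem_source_of_mem_plaque hyp'
  -- the geodesic coordinates of `y`
  obtain ⟨ξ, hξy, hξd, hξl⟩ := hlF.exists_geoCoord hxcl.1 hu
    (hy.trans (ENNReal.ofReal_le_ofReal (by linarith)))
  have hξ : ‖ξ‖ ≤ rF / 2 := by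
    have : 𝔐.leafDist x y ≤ ENNReal.ofReal (rF / 2) := hy
    rw [hξd] at this
    exact (ENNReal.ofReal_le_ofReal_iff (by linarith)).1 this
  have hinv := hlF.geoCoordInv_eq hxcl.1 hu hξl hξy
  unfold comparison
  rw [hinv]
  set ζ := a + ξ with hζdef
  have hζ : ‖ζ‖ ≤ rF := (norm_add_le _ _).trans (by linarith)
  set z := 𝔐.geoCoord i x u ζ with hzdef
  have hQz : 𝔐.leafDist z (𝔐.affPoint i x u ζ) ≤ ENNReal.ofReal (ε0 * rF) :=
    (hA.exp_close ζ (mem_closedBall_zero_iff.2 hζ)).trans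
      (ENNReal.ofReal_le_ofReal (by gcongr))
  have hRy : 𝔐.leafDist y (𝔐.affPoint i x u ξ) ≤ ENNReal.ofReal (ε0 * rF / 2) := by
    have := hA.exp_close ξ (mem_closedBall_zero_iff.2 (by linarith))
    rw [hξy] at this
    exact this.trans (ENNReal.ofReal_le_ofReal (by nlinarith))
  -- The affine approximation first puts `z` within `lF` of `x`; then its distance from `x` is
  -- exactly `‖ζ‖`.
  have hzx : z ∈ 𝔐.leafDisk x rF := by
    have h1 := hA.leafDist_affPoint_le hε0.le hxcl.1 hζ
    have h2 := leafDist_le_of_le (u := lF) (by positivity) her.le h1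
      (by rw [leafDist_comm]; exact hQz) (by nlinarith)
    have h3 := hlF.leafDist_geoCoord hxcl.1 hu (by linarith) h2
    exact h3.le.trans (ENNReal.ofReal_le_ofReal hζ)
  have hzp := hsub hzx
  obtain ⟨hzp', -⟩ := transport_mem_plaque hx'.1 hzp
  set z' := 𝔐.transport i x' z with hz'def
  refine ⟨hzp, ?_⟩
  -- the distance of `y'` and `z'`
  have hRQ : 𝔐.leafDist (𝔐.affPoint i x u ξ) (𝔐.affPoint i x u ζ) ≤
      ENNReal.ofReal ((1 + ε0 / 2) * ‖a‖) := by
    have := hA.leafDist_affCoord_le hε0.le hxcl.1 (a := ξ) (b := ζ) (by linarith) hζ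
    rwa [hζdef, add_sub_cancel_right] at this
  have hyz : 𝔐.leafDist y z ≤ ENNReal.ofReal (rF / 2 + 7 / 4 * (ε0 * rF)) :=
    leafDist_le_of_le (by positivity) her.le (leafDist_le_of_le (u := rF / 2 + 3 / 4 * (ε0 * rF))
      (by positivity) (by positivity) hRy hRQ (by nlinarith))
      (by rw [leafDist_comm]; exact hQz) (by linarith)
  have hyz' := hvar.transport_le her.le hxcl hx' hyp hzp (by positivity) hyz
    (t := rF / 2 + 11 / 4 * (ε0 * rF)) (by linarith)
  obtain ⟨γ, β, v0, hγ, hγv, hv0, hγ1, -, hβd⟩ :=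
    hconv.exists_isPlaqueGeodesic subset_rfl hyp' hzp'
  have hβ : β ≤ rF / 2 + 11 / 4 * (ε0 * rF) :=
    (ENNReal.ofReal_le_ofReal_iff (by positivity)).1 (hβd ▸ hyz')
  have hβ0 := hγ.nonneg
  set b := hv.equiv.symm v0 with hbdef
  have hvb : frameMap v b = v0 := by
    rw [← hv.equiv_apply, hbdef, ContinuousLinearEquiv.apply_symm_apply]
  have hbn : ‖b‖ = β := by
    rw [hv.sq_norm_symm] at hv0
    exact (pow_left_inj₀ (norm_nonneg _) hβ0 two_ne_zero).1 hv0
  have hgeo : ∀ s : ℝ, 𝔐.geoCoord i y' v (s • b) = γ s := fun s => by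
    rw [geoCoord_eq, map_smul, hvb, hγv.leafExp_smul]
  have hbz : 𝔐.geoCoord i y' v b = z' := by
    have := hgeo 1
    rwa [one_smul, hγ1] at this
  have hblF : ‖b‖ ≤ lF := by rw [hbn]; linarith
  refine ⟨⟨b, mem_closedBall_zero_iff.2 hblF, hbz⟩, ?_⟩
  rw [hlF.geoCoordInv_eq hys' hv hblF hbz]
  -- a point `γ s` near `z'` that stays away from the boundary of the disk about `y'`
  obtain ⟨s, hs, hsβ, hsβ'⟩ : ∃ s ∈ Icc (0 : ℝ) 1, s * β ≤ rF / 2 - 2 * (ε0 * rF) ∧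
      -- Of the margin `2 * (ε0 * rF)`, one half is lost in the translation back to the plaque of
      -- `x`, and the other keeps the translate in the disk of radius `(1 - ε0) * rF` about `x`. The
      -- cost is `11/4 + 2 = 19/4`.
      (1 - s) * β ≤ 19 / 4 * (ε0 * rF) := by
    rcases le_total β (rF / 2 - 2 * (ε0 * rF)) with hle | hle
    · exact ⟨1, right_mem_Icc.2 zero_le_one, by linarith, by simp; positivity⟩
    · have hL : 0 < rF / 2 - 2 * (ε0 * rF) := by linarith
      have hβp : 0 < β := hL.trans_le hle
      have hmul := div_mul_cancel₀ (rF / 2 - 2 * (ε0 * rF)) hβp.ne'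
      exact ⟨(rF / 2 - 2 * (ε0 * rF)) / β, ⟨by positivity, (div_le_one hβp).2 hle⟩, hmul.le,
        by rw [sub_mul, hmul]; linarith⟩
  have hp := hγ.mem s hs
  have hpz := hγ.leafDist_le hs (right_mem_Icc.2 zero_le_one) hs.2
  rw [hγ1] at hpz
  have hpz : 𝔐.leafDist (γ s) z' ≤ ENNReal.ofReal (19 / 4 * (ε0 * rF)) :=
    hpz.trans (ENNReal.ofReal_le_ofReal hsβ')
  have hyp1 := hγ.leafDist_le (left_mem_Icc.2 zero_le_one) hs hs.1
  rw [hγv.2.1, sub_zero] at hyp1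
  have hyp1 : 𝔐.leafDist y' (γ s) ≤ ENNReal.ofReal (rF / 2 - 2 * (ε0 * rF)) :=
    hyp1.trans (ENNReal.ofReal_le_ofReal hsβ)
  -- its translate to the plaque of `x`
  obtain ⟨hqp, hqhor⟩ := transport_mem_plaque hxcl hp
  have hqt := transport_transport hxcl hp
  set q := 𝔐.transport i x (γ s) with hqdef
  have hyq : 𝔐.leafDist y q ≤ ENNReal.ofReal (rF / 2 - ε0 * rF) :=
    hvar.le_transport her.le hxcl hx' hyp hqp (s := rF / 2 - 2 * (ε0 * rF)) (by linarith)
      (by rw [hqt]; exact hyp1) (by linarith)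
  have hqz : 𝔐.leafDist q z ≤ ENNReal.ofReal (23 / 4 * (ε0 * rF)) :=
    hvar.le_transport her.le hxcl hx' hqp hzp (s := 19 / 4 * (ε0 * rF)) (by positivity)
      (by rw [hqt]; exact hpz) (by linarith)
  have hqx : q ∈ 𝔐.leafDisk x ((1 - ε0) * rF) :=
    leafDist_le_of_le (by linarith) (by linarith) hy hyq (by linarith)
  have hyx : y ∈ 𝔐.leafDisk x ((1 - ε0) * rF) := leafDisk_mono (by linarith) hy
  -- the position of `q` in affine coordinates
  set ζ' := (1 - 2 * ε0) • ζ with hζ'def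
  have hζ'n : ‖ζ'‖ = (1 - 2 * ε0) * ‖ζ‖ := by
    rw [norm_smul, Real.norm_of_nonneg (by linarith)]
  have hζζ' : ‖ζ' - ζ‖ ≤ 2 * (ε0 * rF) := by
    have : ζ' - ζ = (-(2 * ε0)) • ζ := by rw [hζ'def, sub_smul, neg_smul, one_smul]; abel
    rw [this, norm_smul, norm_neg, Real.norm_of_nonneg (by positivity)]
    linarith [mul_le_mul_of_nonneg_left hζ hε0.le]
  have hζ' : ‖ζ'‖ ≤ (1 - 2 * ε0) * rF := by
    rw [hζ'n]
    exact mul_le_mul_of_nonneg_left hζ (by linarith)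
  have hζ'r : ‖ζ'‖ ≤ rF := by linarith
  have hQ'x : 𝔐.affPoint i x u ζ' ∈ 𝔐.leafDisk x ((1 - ε0) * rF) :=
    (hA.leafDist_affPoint_le hε0.le hxcl.1 hζ'r).trans (ENNReal.ofReal_le_ofReal (by nlinarith))
  have hRx : 𝔐.affPoint i x u ξ ∈ 𝔐.leafDisk x ((1 - ε0) * rF) :=
    (hA.leafDist_affPoint_le hε0.le hxcl.1 (by linarith)).trans
      (ENNReal.ofReal_le_ofReal (by nlinarith))
  have hQQ' := hA.leafDist_affCoord_le hε0.le hxcl.1 hζ hζ'r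
  have hqQ' : 𝔐.leafDist q (𝔐.affPoint i x u ζ') ≤ ENNReal.ofReal (88 / 10 * (ε0 * rF)) :=
    leafDist_le_of_le (s := 27 / 4 * (ε0 * rF)) (by positivity) (by positivity)
      (leafDist_le_of_le (by positivity) her.le hqz hQz (by linarith)) hQQ' (by nlinarith)
  have hN1 := hA.norm_symm_sub_le hlF hu hε0 (by linarith) hr (by linarith) hsub hqx hQ'x
    (by positivity) hqQ'
  have hN2 := hA.norm_symm_sub_le hlF hu hε0 (by linarith) hr (by linarith) hsub hyx hRx
    (by positivity) hRy
  rw [hA.symm_hor_affPoint hu hxcl.1 hζ'r] at hN1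
  rw [hA.symm_hor_affPoint hu hxcl.1 (by linarith)] at hN2
  -- `D` is the displacement from `y'` to `γ s` in the frame `u`. Translation preserves it, so it
  -- can be computed from `y` to `q`.
  set D := hu.equiv.symm (𝔐.hor i (γ s) - 𝔐.hor i y') with hDdef
  have hD : D = hu.equiv.symm (𝔐.hor i q - 𝔐.hor i x) - hu.equiv.symm (𝔐.hor i y - 𝔐.hor i x) := by
    rw [hDdef, hyhor, ← hqhor, ← map_sub, sub_sub_sub_cancel_right]
  have hDa : ‖D - a‖ ≤ 114 / 10 * (ε0 * rF) := by
    have : D - a = (ξ - hu.equiv.symm (𝔐.hor i y - 𝔐.hor i x))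
        - (ζ' - hu.equiv.symm (𝔐.hor i q - 𝔐.hor i x)) + (ζ' - ζ) := by
      rw [hD, hζdef]; abel
    rw [this]
    refine (norm_add_le _ _).trans ((add_le_add_left (norm_sub_le _ _) _).trans ?_)
    nlinarith
  -- the position of `γ s` in affine coordinates about `y'`
  have hsb : ‖s • b‖ ≤ rF / 2 - 2 * (ε0 * rF) := by
    rw [norm_smul, Real.norm_of_nonneg hs.1, hbn]; exact hsβ
  have hsb' : ‖s • b‖ ≤ (1 / 2 - ε0) * rF := by linarith
  have hpR' : 𝔐.leafDist (γ s) (𝔐.affPoint i y' v (s • b)) ≤ ENNReal.ofReal (ε0 * rF / 2) := by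
    have := hA'.exp_close (s • b) (mem_closedBall_zero_iff.2 hsb')
    rw [hgeo] at this
    exact this.trans (ENNReal.ofReal_le_ofReal (by nlinarith))
  have hpy' : γ s ∈ 𝔐.leafDisk y' ((1 - ε0) * ((1 / 2 - ε0) * rF)) :=
    hyp1.trans (ENNReal.ofReal_le_ofReal (by nlinarith))
  have hR'y' : 𝔐.affPoint i y' v (s • b) ∈ 𝔐.leafDisk y' ((1 - ε0) * ((1 / 2 - ε0) * rF)) :=
    (hA'.leafDist_affPoint_le hε0.le hys' hsb').trans (ENNReal.ofReal_le_ofReal (by nlinarith))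
  have hN3 := hA'.norm_symm_sub_le hlF hv hε0 (by linarith) (by nlinarith) (by nlinarith) hsuby' hpy'
    hR'y' (by positivity) hpR'
  rw [hA'.symm_hor_affPoint hv hys' hsb'] at hN3
  have hN4 := hclose D
  have hUD : hu.equiv D = 𝔐.hor i (γ s) - 𝔐.hor i y' := by
    rw [hDdef, ContinuousLinearEquiv.apply_symm_apply]
  rw [hUD] at hN4
  have hDn : ‖D‖ ≤ 51 / 100 * rF := by
    have : ‖D‖ ≤ ‖D - a‖ + ‖a‖ := by simpa using norm_add_le (D - a) a
    linarith
  have hbs : ‖b - s • b‖ ≤ 19 / 4 * (ε0 * rF) := by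
    have : b - s • b = (1 - s) • b := by rw [sub_smul, one_smul]
    rw [this, norm_smul, Real.norm_of_nonneg (by linarith [hs.2]), hbn]
    exact hsβ'
  -- In units of `ε0 * rF` the four terms are at most `19/4` (shortening), slightly over `1/2`
  -- (exponential map at `y'`), `3/2` (change of frame) and `114/10`.
  have hdecomp : b - a = (b - s • b)
      + (s • b - hv.equiv.symm (𝔐.hor i (γ s) - 𝔐.hor i y'))
      + (hv.equiv.symm (𝔐.hor i (γ s) - 𝔐.hor i y') - D) + (D - a) := by abel
  rw [hdecomp]
  refine norm_add₄_le.trans ?_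
  have hN4' : 14 / 5 * ε0 * ‖D‖ ≤ 3 / 2 * (ε0 * rF) := by
    linarith [mul_le_mul_of_nonneg_left hDn hε0.le]
  linarith

end MatchboxManifold

/-! ### Choice of the disks and the frame, and conclusion -/

open MatchboxManifold in
theorem proposition15p3 {n ν : ℕ} {M X : Type*}
    [MetricSpace M] [CompactSpace M] [ConnectedSpace M]
    [MetricSpace X] [CompactSpace X] [TotallyDisconnectedSpace X]
    (𝔐 : MatchboxManifold n ν M X)
    -- a regular covering, with convexity scale `λ_F` and plaque size `δ_U`
    (lF δU : ℝ) (hlF : 𝔐.IsConvexityScale lF) (hδU : 𝔐.IsRegular lF δU)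
    -- the error bound `ε_4` of the affine approximation, and the basic error `ε_0`
    (εn : ℝ) (δn : ℝ → ℝ) (hδn : IsOrthonormalizationModulus n εn δn)
    (ε4 ε0 : ℝ) (hε4 : ε4 ∈ Set.Ioc 0 εn) (hε0 : 0 < ε0) (hε0' : ε0 < 1 / 2000)
    (hε04 : ε0 < ε4 / 20) (hε0δ : ε0 < δn ε4 / 100)
    -- the leafwise scale `r_F`
    (lε : ℝ) (hlε : 𝔐.IsEuclideanScale lF ε0 lε)
    (rF : ℝ) (hrF : rF = min (min δU (lF / 5)) (min lε 1))
    -- the transverse scale `r_*`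
    (rstar : ℝ) (hrstar : 0 < rstar) (hvar : 𝔐.VarLE rstar (ε0 * rF))
    (hdiv : 𝔐.DivLE rstar (ε0 * rF))
    -- the points, and the orthonormal frame at `x`
    (i : Fin ν) (x : M) (hx : 𝔐.leafDisk x rF ⊆ 𝔐.flowBox i)
    (y : M) (hy : y ∈ 𝔐.leafDisk x (rF / 2))
    (x' : M) (hx' : x' ∈ 𝔐.diskSection i x rstar)
    (u : Fin n → Matchbox.E n) (hu : 𝔐.IsFrame i x u) :
    ∃ v : Fin n → Matchbox.E n, 𝔐.IsFrame i (𝔐.transport i x' y) v ∧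
      ∀ a ∈ Metric.closedBall (0 : Matchbox.E n) (rF / 2),
        -- the composition that defines the comparison map makes sense at `a`
        𝔐.geoCoord i x u (a + 𝔐.geoCoordInv lF i x u y) ∈ 𝔐.plaque i (𝔐.trans i x) ∧
        𝔐.transport i x' (𝔐.geoCoord i x u (a + 𝔐.geoCoordInv lF i x u y)) ∈
          𝔐.geoCoord i (𝔐.transport i x' y) v '' Metric.closedBall 0 lF ∧
        -- and the comparison map is close to the identity
        ‖𝔐.comparison lF i x x' y u v a - a‖ ≤ ε4 * rF := by
  have hlF0 : 0 < lF := hlF.1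
  have hr : 0 < rF := by
    rw [hrF]
    exact lt_min (lt_min hδU.1 (by linarith)) (lt_min hlε.1 one_pos)
  have hrlF : rF ≤ lF / 5 := hrF ▸ (min_le_left _ _).trans (min_le_right _ _)
  have hrlε : rF ≤ lε := hrF ▸ (min_le_right _ _).trans (min_le_left _ _)
  have her : 0 < ε0 * rF := by positivity
  have heer : 0 < ε0 * (ε0 * rF) := by positivity
  have heer' : ε0 * (ε0 * rF) ≤ ε0 * rF / 2000 := by nlinarith
  have her' : ε0 * rF ≤ rF / 2000 := by nlinarith
  -- the disks about `x`, `x'` and `y'`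
  have hxcl : x ∈ 𝔐.closedFlowBox i := by
    have := hx (mem_leafDisk_self x rF)
    exact ⟨this.1, fun k => (this.2 k).le⟩
  have hxp : x ∈ 𝔐.plaque i (𝔐.trans i x) := ⟨hxcl, rfl⟩
  have hsub : 𝔐.leafDisk x rF ⊆ 𝔐.plaque i (𝔐.trans i x) :=
    hlF.leafDisk_subset_plaque hxp hr (by linarith) fun q hq _ => (hx hq).2
  have hA : 𝔐.ApproxEuclidean ε0 rF i x u :=
    hlε.2 rF hr hrlε (by linarith) i x hxcl hsub u hu
  have hsub' : 𝔐.leafDisk x' ((1 - ε0) * rF) ⊆ 𝔐.plaque i (𝔐.trans i x') := by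
    have := hlF.leafDisk_transport_subset hvar her.le hxcl hx' hxp hx (l := (1 - ε0) * rF)
      (by nlinarith) (by nlinarith) (by linarith)
    rwa [transport_self hx'.1.1 hx'.2.1] at this
  have hyp : y ∈ 𝔐.plaque i (𝔐.trans i x) := hsub (leafDisk_mono (by linarith) hy)
  obtain ⟨hyp', hyhor⟩ := transport_mem_plaque hx'.1 hyp
  set y' := 𝔐.transport i x' y with hy'def
  have hys' := mem_source_of_mem_plaque hyp'
  have hytr : 𝔐.trans i y' = 𝔐.trans i x' := hyp'.2
  -- Only the disk of radius `rF / 2` about `y` is known to lie in the flow box, and translation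
  -- costs `ε0 * rF`.
  have hsuby' : 𝔐.leafDisk y' ((1 / 2 - ε0) * rF) ⊆ 𝔐.plaque i (𝔐.trans i y') := by
    rw [hytr]
    exact hlF.leafDisk_transport_subset hvar her.le hxcl hx' hyp (ρ := rF / 2)
      ((leafDisk_subset_leafDisk (by linarith) (by linarith) hy (by linarith)).trans hx)
      (by nlinarith) (by nlinarith) (by linarith)
  have hxy' : y' ∈ 𝔐.leafDisk x' ((1 - ε0) * ((1 - ε0) * rF)) := by
    have := hvar.transport_le her.le hxcl hx' hxp hyp (by linarith) hy
      (t := (1 - ε0) * ((1 - ε0) * rF)) (by nlinarith)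
    rwa [transport_self hx'.1.1 hx'.2.1] at this
  -- the frame at `y'`
  obtain ⟨v, hv, hclose⟩ := exists_isFrame_close hlF hε0 hε0' hr (by linarith) hvar hxcl hx' hA hu
    hsub (fun u' hu' => hlε.2 _ (by nlinarith) (by nlinarith) (by nlinarith) i x' hx'.1 hsub' u' hu')
    hsub' hxy'
  have hA' : 𝔐.ApproxEuclidean ε0 ((1 / 2 - ε0) * rF) i y' v :=
    hlε.2 _ (by nlinarith) (by nlinarith) (by nlinarith) i y' hyp'.1 hsuby' v hv
  refine ⟨v, hv, fun a ha => ?_⟩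
  obtain ⟨h1, h2, h3⟩ := comparison_sub_le hlF hε0 hε0' hr hrlF hvar hxcl
    (hδU.2.2 i _ (mem_T_of_mem_plaque hyp')).1 hx' hsub hA hu hy hsuby' hA' hv hclose
    (mem_closedBall_zero_iff.1 ha)
  exact ⟨h1, h2, h3.trans (by nlinarith)⟩
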